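/- Throughout, $|\cdot|$ denotes the sup-norm. For a real $n\times m$ matrix $\Theta$ ($n,m\ge 1$), the \emph{uniform Diophantine exponent} $\hat\omega(\Theta)\in[-\infty,+\infty]$ is the supremum of all real $\gamma$ such that for every sufficiently large $t$ the system \[ |\vec x|\le t,\qquad |\Theta\vec x-\vec y|\le t^{-\gamma} \] has a nonzero solution $(\vec x,\vec y)\in\mathbb Z^m\oplus\mathbb Z^n$. For an $n$-tuple $\theta=(\theta_1,\dots,\theta_n)\in\mathbb R^n$, $\hat\omega(\theta)$ is the supremum of all real $\gamma$ such that for every sufficiently large $t$ the system $0<|x|\le t$, $\max_{1\le i\le n}|\theta_i x-y_i|\le t^{-\gamma}$ has a solution in integers $x,y_1,\dots,y_n$, and $\hat\omega(L_\theta)$ is the supremum of all real $\gamma$ such that for every sufficiently large $t$ the system $0<\max_{1\le i\le n}|x_i|\le t$, $|\theta_1x_1+\dots+\theta_nx_n-y|\le t^{-\gamma}$ has a solution in integers $x_1,\dots,x_n,y$. Below, $1/(+\infty)=0$, and a quotient with denominator $0$ is understood as $+\infty$. \textbf{Theorem.} (1) Let $n,m\ge1$, $m+n\ge3$. For every real $n\times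 m$ matrix $\Theta$, with transpose ${}^{\mathsf T}\Theta$, \[ \hat\omega({}^{\mathsf T}\Theta)\ \ge\ \begin{cases}\dfrac{n-1}{m-\hat\omega(\Theta)} & \text{if } \hat\omega(\Theta)\le 1,\\[2ex] \dfrac{n-\hat\omega(\Theta)^{-1}}{m-1} & \text{if } \hat\omega(\Theta)\ge 1.\end{cases} \] (2) Let $n\ge2$. For every $\theta\in\mathbb R^n\setminus\mathbb Q^n$, \[ \hat\omega(L_\theta)\ \ge\ \frac{n-1}{1-\hat\omega(\theta)},\qquad \hat\omega(\theta)\ \ge\ \frac{1-\hat\omega(L_\theta)^{-1}}{n-1}. \] -/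

import Mathlib

open Filter

/-- The uniform Diophantine exponent of a real `n × m` matrix `Θ`, an element of `[-∞, +∞]`:
the supremum of the real `γ` such that for every `t` large enough the system
`|x| ≤ t`, `|Θ x - y| ≤ t ^ (-γ)` has a nonzero solution `(x, y) ∈ ℤ^m ⊕ ℤ^n`.
The norm on `Fin k → ℝ` is the sup-norm. -/
noncomputable def uniformExponent {n m : ℕ} (Θ : Matrix (Fin n) (Fin m) ℝ) : EReal :=
  sSup ((fun γ : ℝ => (γ : EReal)) '' {γ : ℝ | ∀ᶠ t : ℝ in atTop,
    ∃ (x : Fin m → ℤ) (y : Fin n → ℤ), (x, y) ≠ 0 ∧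
      ‖(fun j => (x j : ℝ))‖ ≤ t ∧
      ‖Θ.mulVec (fun j => (x j : ℝ)) - (fun i => (y i : ℝ))‖ ≤ t ^ (-γ)})

/-- The uniform Diophantine exponent of an `n`-tuple `θ` (simultaneous approximation):
the supremum of the real `γ` such that for every `t` large enough the system
`0 < |x| ≤ t`, `max_i |θ i * x - y i| ≤ t ^ (-γ)` has a solution in integers `x, y 1, …, y n`. -/
noncomputable def uniformExponentTuple {n : ℕ} (θ : Fin n → ℝ) : EReal :=
  sSup ((fun γ : ℝ => (γ : EReal)) '' {γ : ℝ | ∀ᶠ t : ℝ in atTop,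
    ∃ (x : ℤ) (y : Fin n → ℤ), 0 < |(x : ℝ)| ∧ |(x : ℝ)| ≤ t ∧
      ‖(fun i => θ i * (x : ℝ) - (y i : ℝ))‖ ≤ t ^ (-γ)})

/-- The uniform Diophantine exponent of the linear form
`L(x 1, …, x n, y) = θ 1 * x 1 + … + θ n * x n - y`:
the supremum of the real `γ` such that for every `t` large enough the system
`0 < max_i |x i| ≤ t`, `|L(x, y)| ≤ t ^ (-γ)` has a solution in integers `x 1, …, x n, y`. -/
noncomputable def uniformExponentForm {n : ℕ} (θ : Fin n → ℝ) : EReal :=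
  sSup ((fun γ : ℝ => (γ : EReal)) '' {γ : ℝ | ∀ᶠ t : ℝ in atTop,
    ∃ (x : Fin n → ℤ) (y : ℤ), 0 < ‖(fun i => (x i : ℝ))‖ ∧ ‖(fun i => (x i : ℝ))‖ ≤ t ∧
      |(∑ i, θ i * (x i : ℝ)) - (y : ℝ)| ≤ t ^ (-γ)})

/-- Quotient in `[-∞, +∞]` with the convention `a / 0 = +∞`
(Mathlib's division on `EReal` has `a / 0 = 0`); it is only used with `a > 0` and `b ≥ 0`. -/
noncomputable def quotTop (a b : EReal) : EReal :=
  open Classical in if b = 0 then ⊤ else a / b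

/-! Take the box |x'| ≤ X, |Θᵀx' - y'| ≤ 1/A with A = X^β. If β is at least Dirichlet's exponent,
then ρ = X^n / A^m is at most 1, and Minkowski's theorem alone falls short by the factor ρ. The
missing volume comes from Θ. Each integer point (x, y) gives the form y·x' - x·y', which is integral
at integer points and whose coordinates in the system (x', Θᵀx' - y') are y - Θx and x. Replace one
form of the system by it, with bound 1/2: integrality forces it to vanish, and the determinant
becomes a single coordinate. Up to constants this works once X|Θx - y| and |x|/A are at most ρ
(`exists_int_of_one_integral`). Two independent points replace two forms, and then the 2×2 minors of
their coordinates must be small (`exists_int_of_two_integral`).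

It remains to find one such point or two consecutive best approximations. Let φ(N) be the best
quality among |x| ≤ N. From φ(N) ≤ C(N+1)^(-γ), with γ below the exponent of Θ, the search becomes a
question about nonincreasing sequences (`HasSmallRecords`). For γ ≤ 1 it is solved when A^γ ρ = X
(`hasSmallRecords_of_le_one`), for γ ≥ 1 when (Aρ)^γ = X (`hasSmallRecords_of_one_le`). Putting A =
X^β, these equations read β = (n-1)/(m-γ) and β = (n-1/γ)/(m-1), and γ then tends to the exponent of
Θ.

The second part is the case of one column: irrationality gives ω̂(θ) ≤ 1, Dirichlet gives ω̂(L_θ) ≥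
1, so each inequality is one branch of the first part. -/

/-! ### Minkowski's theorem with integer-valued forms -/

open MeasureTheory in
/-- **Minkowski's linear forms theorem**, with a strict inequality on the determinant. -/
theorem exists_int_abs_mulVec_le {ι : Type*} [Fintype ι] [DecidableEq ι] (B : Matrix ι ι ℝ)
    (c : ι → ℝ) (hc : ∀ i, 0 < c i) (hB : B.det ≠ 0) (h : |B.det| < ∏ i, c i) :
    ∃ w : ι → ℤ, w ≠ 0 ∧ ∀ i, |(B.mulVec fun j => (w j : ℝ)) i| ≤ c i := by
  classical
  let b := Pi.basisFun ℝ ι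
  let s : Set (ι → ℝ) := (Matrix.toLin' B) ⁻¹' (Set.Icc (-c) c)
  have hdet : LinearMap.det (Matrix.toLin' B) = B.det := LinearMap.det_toLin' B
  have hvol : volume s = ENNReal.ofReal (|B.det|⁻¹ * (2 ^ Fintype.card ι * ∏ i, c i)) := by
    rw [Measure.addHaar_preimage_linearMap _ (by rwa [hdet]), hdet, Real.volume_Icc_pi,
      ← ENNReal.ofReal_prod_of_nonneg, ← ENNReal.ofReal_mul (abs_nonneg _), abs_inv]
    · congr 2
      rw [← Finset.card_univ, ← Finset.prod_const, ← Finset.prod_mul_distrib]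
      refine Finset.prod_congr rfl fun i _ => ?_
      simp only [Pi.neg_apply]; ring
    · intro i _
      have := hc i
      simp only [Pi.neg_apply]; linarith
  have hfund : volume (ZSpan.fundamentalDomain b) = 1 := by
    rw [ZSpan.fundamentalDomain_pi_basisFun, volume_pi, Measure.pi_pi]
    simp
  have hpos : 0 < |B.det| := abs_pos.2 hB
  have : Countable (Submodule.span ℤ (Set.range b)).toAddSubgroup :=
    inferInstanceAs (Countable (Submodule.span ℤ (Set.range b)))
  have key := exists_ne_zero_mem_lattice_of_measure_mul_two_pow_lt_measure (μ := volume) (s := s)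
    (L := (Submodule.span ℤ (Set.range b)).toAddSubgroup)
    (ZSpan.isAddFundamentalDomain b volume)
    (by
      intro x hx
      simp only [s, Set.mem_preimage, map_neg, Set.mem_Icc] at hx ⊢
      exact ⟨neg_le_neg hx.2, by simpa using neg_le_neg hx.1⟩)
    ((convex_Icc _ _).linear_preimage _)
    (by
      rw [hfund, hvol, one_mul, Module.finrank_fintype_fun_eq_card,
        show (2 : ENNReal) ^ Fintype.card ι = ENNReal.ofReal (2 ^ Fintype.card ι) by
          rw [ENNReal.ofReal_pow (by norm_num)]; simp]
      have hprod : 0 < ∏ i, c i := Finset.prod_pos fun i _ => hc i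
      refine (ENNReal.ofReal_lt_ofReal_iff (by positivity)).2 ?_
      rw [inv_mul_eq_div, lt_div_iff₀ hpos]
      gcongr)
  obtain ⟨⟨x, hxL⟩, hx0, hxs⟩ := key
  have hmem : ∀ i, ∃ k : ℤ, (k : ℝ) = x i := by
    have : x ∈ Submodule.span ℤ (Set.range b) := hxL
    rw [b.mem_span_iff_repr_mem ℤ] at this
    intro i
    obtain ⟨k, hk⟩ := this i
    exact ⟨k, by simpa [b] using hk⟩
  choose w hw using hmem
  have hwx : (fun j => (w j : ℝ)) = x := funext hw
  refine ⟨w, ?_, fun i => ?_⟩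
  · rintro rfl
    apply hx0
    ext i
    simp [← hw i]
  · rw [hwx, abs_le]
    simp only [s, Set.mem_preimage, Set.mem_Icc, Matrix.toLin'_apply] at hxs
    exact ⟨hxs.1 i, hxs.2 i⟩

open Matrix in
/-- Minkowski's theorem for a unimodular system of forms in which the forms with indices `s a`
have been replaced by combinations `ζ a` that take integer values: these must then vanish. -/
theorem exists_int_dotProduct_eq_zero {ι κ : Type*} [Fintype ι] [DecidableEq ι] [Fintype κ]
    [DecidableEq κ] (A : Matrix ι ι ℝ) (hA : |A.det| = 1) (s : κ → ι) (hs : s.Injective)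
    (ζ : κ → ι → ℝ) (hζ : ∀ a (w : ι → ℤ), ∃ k : ℤ, ζ a ⬝ᵥ (A *ᵥ fun j => (w j : ℝ)) = k)
    (c : ι → ℝ) (hc : ∀ i, 0 < c i) (hcs : ∀ a, c (s a) < 1)
    (h0 : (Matrix.of fun a b => ζ a (s b)).det ≠ 0)
    (h : |(Matrix.of fun a b => ζ a (s b)).det| < ∏ i, c i) :
    ∃ w : ι → ℤ, w ≠ 0 ∧ (∀ a, ζ a ⬝ᵥ (A *ᵥ fun j => (w j : ℝ)) = 0) ∧
      ∀ i, i ∉ Set.range s → |(A *ᵥ fun j => (w j : ℝ)) i| ≤ c i := by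
  -- `1 + U * V` is the identity with row `s a` replaced by `ζ a`. Since det(1 + UV) = det(1 + VU),
  -- its determinant is the minor of `ζ` on the columns `s`.
  let U : Matrix ι κ ℝ := Matrix.of fun i a => if i = s a then 1 else 0
  let V : Matrix κ ι ℝ := Matrix.of fun a j => ζ a j - if j = s a then 1 else 0
  have hVU : (1 + V * U) = Matrix.of fun a b => ζ a (s b) := by
    ext a b
    simp [U, V, Matrix.mul_apply, Matrix.one_apply, hs.eq_iff, eq_comm]
  have hdet : |((1 + U * V) * A).det| = |(Matrix.of fun a b => ζ a (s b)).det| := by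
    rw [Matrix.det_mul, abs_mul, hA, mul_one, Matrix.det_one_add_mul_comm, hVU]
  obtain ⟨w, hw0, hw⟩ := exists_int_abs_mulVec_le ((1 + U * V) * A) c hc
    (by rw [← abs_pos, hdet]; exact abs_pos.2 h0) (by rwa [hdet])
  have hform : ∀ u : ι → ℝ, ∀ i, ((1 + U * V) *ᵥ u) i
      = u i + ∑ a, if i = s a then ζ a ⬝ᵥ u - u (s a) else 0 := by
    intro u i
    rw [Matrix.add_mulVec, Matrix.one_mulVec, ← Matrix.mulVec_mulVec]
    simp only [Pi.add_apply, add_right_inj]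
    simp only [Matrix.mulVec, U, V, dotProduct, Matrix.of_apply, sub_mul, ite_mul, one_mul,
      zero_mul, Finset.sum_sub_distrib, Finset.sum_ite_eq', Finset.mem_univ, if_true]
  refine ⟨w, hw0, fun a => ?_, fun i hi => ?_⟩
  · have h1 := hw (s a)
    rw [← Matrix.mulVec_mulVec, hform] at h1
    obtain ⟨k, hk⟩ := hζ a w
    simp only [hs.eq_iff, Finset.sum_ite_eq, Finset.mem_univ, if_true, add_sub_cancel] at h1
    have h2 := h1.trans_lt (hcs a)
    rw [hk] at h2 ⊢
    have : |k| < 1 := by exact_mod_cast h2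
    rw [Int.abs_lt_one_iff] at this
    simp [this]
  · have h1 := hw i
    rw [← Matrix.mulVec_mulVec, hform, Finset.sum_eq_zero, add_zero] at h1
    · exact h1
    · intro a _
      exact if_neg fun h => hi ⟨a, h.symm⟩

-- Drop the coordinate `p` that maximizes `c p * |ζ p|` and put `ζ` in its place with bound 1/2.
-- Then `ζ` vanishes at the point found, and this equation bounds the dropped coordinate by the
-- others: by maximality each term costs at most `c p`, whence the factor `Fintype.card ι`.
open Matrix in
theorem exists_int_of_one_integral {ι : Type*} [Fintype ι] [DecidableEq ι]
    (A : Matrix ι ι ℝ) (hA : |A.det| = 1) (ζ : ι → ℝ) (hζ0 : ζ ≠ 0)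
    (hζ : ∀ (w : ι → ℤ), ∃ k : ℤ, ζ ⬝ᵥ (A *ᵥ fun j => (w j : ℝ)) = k)
    (c : ι → ℝ) (hc : ∀ i, 0 < c i) (h : ∀ p, c p * |ζ p| < (∏ i, c i) / 2) :
    ∃ w : ι → ℤ, w ≠ 0 ∧
      ∀ i, |(A *ᵥ fun j => (w j : ℝ)) i| ≤ Fintype.card ι * c i := by
  obtain ⟨p₀, hp₀⟩ := Function.ne_iff.1 hζ0
  obtain ⟨p, -, hp⟩ := Finset.exists_max_image Finset.univ (fun p => c p * |ζ p|) ⟨p₀, by simp⟩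
  have hζp : 0 < |ζ p| := by
    have h1 := hp p₀ (by simp)
    have h2 : 0 < c p₀ * |ζ p₀| := mul_pos (hc _) (abs_pos.2 hp₀)
    exact pos_of_mul_pos_right (h2.trans_le h1) (hc p).le
  have hprod : ∏ i, Function.update c p (1 / 2) i = (1 / 2) * ((∏ i, c i) / c p) := by
    rw [Finset.prod_update_of_mem (Finset.mem_univ p),
      ← Finset.mul_prod_erase Finset.univ c (Finset.mem_univ p),
      mul_div_cancel_left₀ _ (hc p).ne', Finset.sdiff_singleton_eq_erase]
  obtain ⟨w, hw0, hw1, hw2⟩ := exists_int_dotProduct_eq_zero (κ := Unit) A hA (fun _ => p)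
    (fun _ _ _ => rfl) (fun _ => ζ) (fun _ => hζ) (Function.update c p (1 / 2))
    (by
      intro i
      rcases eq_or_ne i p with rfl | hi
      · simp
      · rw [Function.update_of_ne hi]; exact hc i)
    (by intro; simp; norm_num)
    (by simpa using hζp)
    (by
      rw [hprod]
      have h1 := h p
      have h2 := hc p
      simp only [det_unique, of_apply]
      rw [← mul_div_assoc, lt_div_iff₀ h2]
      linarith)
  have hcard : (1 : ℝ) ≤ Fintype.card ι := by
    exact_mod_cast Fintype.card_pos_iff.2 ⟨p⟩
  refine ⟨w, hw0, fun i => ?_⟩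
  set u := A *ᵥ fun j => (w j : ℝ)
  have hle : ∀ i, i ≠ p → |u i| ≤ c i := by
    intro i hi
    have := hw2 i (by rintro ⟨_, rfl⟩; exact hi rfl)
    rwa [Function.update_of_ne hi] at this
  rcases eq_or_ne i p with rfl | hi
  · have h1 : ζ i * u i = - ∑ j ∈ Finset.univ.erase i, ζ j * u j := by
      have := hw1 ()
      rw [dotProduct, ← Finset.add_sum_erase _ _ (Finset.mem_univ i)] at this
      linarith
    have h2 : |ζ i| * |u i| ≤ |ζ i| * (Fintype.card ι * c i) := by
      rw [← abs_mul, h1, abs_neg]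
      refine (Finset.abs_sum_le_sum_abs _ _).trans ?_
      have : ∀ j ∈ Finset.univ.erase i, |ζ j * u j| ≤ c i * |ζ i| := by
        intro j hj
        rw [abs_mul, mul_comm]
        exact (mul_le_mul_of_nonneg_right (hle j (Finset.ne_of_mem_erase hj))
          (abs_nonneg _)).trans (hp j (by simp))
      refine (Finset.sum_le_card_nsmul _ _ _ this).trans ?_
      rw [nsmul_eq_mul]
      have h3 : ((Finset.univ.erase i).card : ℝ) ≤ Fintype.card ι := by
        exact_mod_cast Finset.card_le_univ _
      have h4 : 0 ≤ c i * |ζ i| := mul_nonneg (hc i).le (abs_nonneg _)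
      nlinarith
    exact le_of_mul_le_mul_left h2 hζp
  · exact (hle i hi).trans (le_mul_of_one_le_left (hc i).le hcard)

-- The same argument with two forms: the dropped pair maximizes the weighted 2×2 minor, and Cramer's
-- rule recovers both dropped coordinates from the two vanishing equations.
open Matrix in
theorem exists_int_of_two_integral {ι : Type*} [Fintype ι] [DecidableEq ι]
    (A : Matrix ι ι ℝ) (hA : |A.det| = 1) (ζ ξ : ι → ℝ)
    (hne : ∃ p q, ζ p * ξ q - ζ q * ξ p ≠ 0)
    (hζ : ∀ (w : ι → ℤ), ∃ k : ℤ, ζ ⬝ᵥ (A *ᵥ fun j => (w j : ℝ)) = k)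
    (hξ : ∀ (w : ι → ℤ), ∃ k : ℤ, ξ ⬝ᵥ (A *ᵥ fun j => (w j : ℝ)) = k)
    (c : ι → ℝ) (hc : ∀ i, 0 < c i)
    (h : ∀ p q, c p * c q * |ζ p * ξ q - ζ q * ξ p| < (∏ i, c i) / 4) :
    ∃ w : ι → ℤ, w ≠ 0 ∧
      ∀ i, |(A *ᵥ fun j => (w j : ℝ)) i| ≤ Fintype.card ι * c i := by
  obtain ⟨p₀, q₀, h₀⟩ := hne
  obtain ⟨⟨p, q⟩, -, hpq⟩ := Finset.exists_max_image (Finset.univ : Finset (ι × ι))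
    (fun p => c p.1 * c p.2 * |ζ p.1 * ξ p.2 - ζ p.2 * ξ p.1|) ⟨(p₀, q₀), by simp⟩
  have hmax : ∀ i j, c i * c j * |ζ i * ξ j - ζ j * ξ i|
      ≤ c p * c q * |ζ p * ξ q - ζ q * ξ p| := fun i j => hpq (i, j) (by simp)
  have hM : 0 < |ζ p * ξ q - ζ q * ξ p| := by
    have h1 := hmax p₀ q₀
    have h2 : 0 < c p₀ * c q₀ * |ζ p₀ * ξ q₀ - ζ q₀ * ξ p₀| :=
      mul_pos (mul_pos (hc _) (hc _)) (abs_pos.2 h₀)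
    exact pos_of_mul_pos_right (h2.trans_le h1) (mul_pos (hc p) (hc q)).le
  have hne : q ≠ p := by
    rintro rfl
    simp at hM
  let c' := Function.update (Function.update c p (1 / 2)) q (1 / 2)
  have hprod : ∏ i, c' i = (1 / 4) * ((∏ i, c i) / (c p * c q)) := by
    have hp : p ∈ Finset.univ.erase q := by simp [hne.symm]
    rw [Finset.prod_update_of_mem (Finset.mem_univ q), Finset.sdiff_singleton_eq_erase,
      Finset.prod_update_of_mem hp,
      ← Finset.mul_prod_erase Finset.univ c (Finset.mem_univ q),
      ← Finset.mul_prod_erase _ c hp, Finset.sdiff_singleton_eq_erase]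
    have h1 := (hc p).ne'
    have h2 := (hc q).ne'
    field_simp
    ring
  have hc'p : c' p = 1 / 2 := by simp [c', Function.update_of_ne hne.symm]
  have hc'q : c' q = 1 / 2 := by simp [c']
  have hc' : ∀ i, i ≠ p → i ≠ q → c' i = c i := fun i h1 h2 => by
    simp [c', Function.update_of_ne h1, Function.update_of_ne h2]
  obtain ⟨w, hw0, hw1, hw2⟩ := exists_int_dotProduct_eq_zero (κ := Fin 2) A hA ![p, q]
    (by
      intro a b hab
      fin_cases a <;> fin_cases b <;> simp_all) ![ζ, ξ]
    (by
      intro a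
      fin_cases a
      · exact hζ
      · exact hξ) c'
    (by
      intro i
      rcases eq_or_ne i p with rfl | hi
      · rw [hc'p]; norm_num
      rcases eq_or_ne i q with rfl | hi'
      · rw [hc'q]; norm_num
      · rw [hc' i hi hi']; exact hc i)
    (by
      intro a
      fin_cases a
      · simp [hc'p]; norm_num
      · simp [hc'q]; norm_num)
    (by simpa [det_fin_two] using abs_pos.1 hM)
    (by
      rw [hprod]
      have h1 := h p q
      have h2 := mul_pos (hc p) (hc q)
      simp only [det_fin_two, of_apply, cons_val_zero, cons_val_one]
      rw [← mul_div_assoc, lt_div_iff₀ h2]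
      linarith)
  have hcard : (1 : ℝ) ≤ Fintype.card ι := by
    exact_mod_cast Fintype.card_pos_iff.2 ⟨p⟩
  refine ⟨w, hw0, fun i => ?_⟩
  set u := A *ᵥ fun j => (w j : ℝ)
  have hle : ∀ i, i ≠ p → i ≠ q → |u i| ≤ c i := by
    intro i h1 h2
    have := hw2 i (by
      rintro ⟨a, ha⟩
      fin_cases a
      · exact h1 ha.symm
      · exact h2 ha.symm)
    rwa [hc' i h1 h2] at this
  have hζu : ∑ j, ζ j * u j = 0 := hw1 0
  have hξu : ∑ j, ξ j * u j = 0 := hw1 1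
  -- the two equations determine the coordinate `r` of `u` by Cramer's rule
  have cramer : ∀ r s, c r * c s * |ζ r * ξ s - ζ s * ξ r|
      = c p * c q * |ζ p * ξ q - ζ q * ξ p| → (∀ j, j ≠ r → j ≠ s → |u j| ≤ c j) →
      |u r| ≤ Fintype.card ι * c r := by
    intro r s hrs hus
    have hpos : 0 < c r * c s * |ζ r * ξ s - ζ s * ξ r| := by
      rw [hrs]; exact mul_pos (mul_pos (hc _) (hc _)) hM
    have hpos' : 0 < |ζ r * ξ s - ζ s * ξ r| :=
      pos_of_mul_pos_right hpos (mul_pos (hc _) (hc _)).le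
    have h1 : (ζ r * ξ s - ζ s * ξ r) * u r
        = - ∑ j ∈ Finset.univ.erase r, (ζ j * ξ s - ζ s * ξ j) * u j := by
      have h2 : ∑ j, (ζ j * ξ s - ζ s * ξ j) * u j = 0 := by
        calc ∑ j, (ζ j * ξ s - ζ s * ξ j) * u j
            = ξ s * ∑ j, ζ j * u j - ζ s * ∑ j, ξ j * u j := by
              rw [Finset.mul_sum, Finset.mul_sum, ← Finset.sum_sub_distrib]
              exact Finset.sum_congr rfl fun j _ => by ring
          _ = 0 := by rw [hζu, hξu]; ring
      rw [← Finset.add_sum_erase _ _ (Finset.mem_univ r)] at h2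
      linarith
    have h2 : |ζ r * ξ s - ζ s * ξ r| * |u r|
        ≤ |ζ r * ξ s - ζ s * ξ r| * (Fintype.card ι * c r) := by
      rw [← abs_mul, h1, abs_neg]
      refine (Finset.abs_sum_le_sum_abs _ _).trans ?_
      have hterm : ∀ j ∈ Finset.univ.erase r,
          |(ζ j * ξ s - ζ s * ξ j) * u j| ≤ c r * |ζ r * ξ s - ζ s * ξ r| := by
        intro j hj
        rcases eq_or_ne j s with rfl | hjs
        · rw [mul_comm (ζ j), sub_self, zero_mul, abs_zero]
          exact mul_nonneg (hc r).le (abs_nonneg _)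
        · rw [abs_mul]
          have h3 := hus j (Finset.ne_of_mem_erase hj) hjs
          have h4 := hmax j s
          rw [← hrs] at h4
          have h5 : c s * (c j * |ζ j * ξ s - ζ s * ξ j|)
              ≤ c s * (c r * |ζ r * ξ s - ζ s * ξ r|) := by linarith
          have h6 := le_of_mul_le_mul_left h5 (hc s)
          have := mul_le_mul_of_nonneg_left h3 (abs_nonneg (ζ j * ξ s - ζ s * ξ j))
          linarith
      refine (Finset.sum_le_card_nsmul _ _ _ hterm).trans ?_
      rw [nsmul_eq_mul]
      have h3 : ((Finset.univ.erase r).card : ℝ) ≤ Fintype.card ι := by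
        exact_mod_cast Finset.card_le_univ _
      have h4 : 0 ≤ c r * |ζ r * ξ s - ζ s * ξ r| := mul_nonneg (hc r).le (abs_nonneg _)
      nlinarith
    exact le_of_mul_le_mul_left h2 hpos'
  by_cases hip : i = p
  · subst hip
    exact cramer i q rfl hle
  by_cases hiq : i = q
  · subst hiq
    refine cramer i p ?_ fun j h1 h2 => hle j h2 h1
    rw [abs_sub_comm, mul_comm (c i)]
  · exact (hle i hip hiq).trans (le_mul_of_one_le_left (hc i).le hcard)

/-! ### The transposed system and the integral forms given by points (x, y) -/

/-- The system of linear forms `(x', Θᵀ x' - y')` in the variables `(x', y')`. -/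
def transposeForms {n m : ℕ} (Θ : Matrix (Fin n) (Fin m) ℝ) :
    Matrix (Fin n ⊕ Fin m) (Fin n ⊕ Fin m) ℝ :=
  Matrix.fromBlocks 1 0 Θ.transpose (-1)

theorem abs_det_transposeForms {n m : ℕ} (Θ : Matrix (Fin n) (Fin m) ℝ) :
    |(transposeForms Θ).det| = 1 := by
  rw [transposeForms, Matrix.det_fromBlocks_zero₁₂, Matrix.det_neg]
  simp

/-- The coordinates of the linear form `(x', y') ↦ y ⬝ x' - x ⬝ y'` with respect to
`transposeForms Θ`. -/
def formCoord {n m : ℕ} (Θ : Matrix (Fin n) (Fin m) ℝ) (x : Fin m → ℤ) (y : Fin n → ℤ) :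
    Fin n ⊕ Fin m → ℝ :=
  Sum.elim (fun i => (y i : ℝ) - Θ.mulVec (fun j => (x j : ℝ)) i) (fun j => (x j : ℝ))

open Matrix in
theorem transposeForms_mulVec {n m : ℕ} (Θ : Matrix (Fin n) (Fin m) ℝ) (w : Fin n ⊕ Fin m → ℝ) :
    transposeForms Θ *ᵥ w = Sum.elim (w ∘ Sum.inl) (Θᵀ *ᵥ (w ∘ Sum.inl) - w ∘ Sum.inr) := by
  rw [transposeForms, Matrix.fromBlocks_mulVec]
  simp [Matrix.neg_mulVec, sub_eq_add_neg]

-- The terms containing Θ cancel because x·Θᵀx' = Θx·x'; what remains is y·x' - x·y'.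
open Matrix in
theorem formCoord_integral {n m : ℕ} (Θ : Matrix (Fin n) (Fin m) ℝ) (x : Fin m → ℤ)
    (y : Fin n → ℤ) (w : Fin n ⊕ Fin m → ℤ) :
    ∃ k : ℤ, formCoord Θ x y ⬝ᵥ (transposeForms Θ *ᵥ fun i => (w i : ℝ)) = k := by
  refine ⟨∑ i, y i * w (Sum.inl i) - ∑ j, x j * w (Sum.inr j), ?_⟩
  rw [transposeForms_mulVec, formCoord, sumElim_dotProduct_sumElim]
  set a : Fin n → ℝ := (fun i => (w i : ℝ)) ∘ Sum.inl
  set b : Fin m → ℝ := (fun i => (w i : ℝ)) ∘ Sum.inr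
  set v : Fin m → ℝ := fun j => (x j : ℝ)
  have h1 : (fun i => (y i : ℝ) - (Θ *ᵥ v) i) = (fun i => (y i : ℝ)) - Θ *ᵥ v := rfl
  have h2 : v ⬝ᵥ (Θᵀ *ᵥ a) = (Θ *ᵥ v) ⬝ᵥ a := by
    rw [Matrix.mulVec_transpose, dotProduct_comm, ← Matrix.dotProduct_mulVec, dotProduct_comm]
  rw [h1, sub_dotProduct, dotProduct_sub, h2]
  simp only [dotProduct, a, b, v, Function.comp]
  push_cast
  ring

theorem abs_formCoord_inl_le {n m : ℕ} (Θ : Matrix (Fin n) (Fin m) ℝ) (x : Fin m → ℤ)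
    (y : Fin n → ℤ) (i : Fin n) : |formCoord Θ x y (Sum.inl i)|
      ≤ ‖Θ.mulVec (fun j => (x j : ℝ)) - (fun i => (y i : ℝ))‖ := by
  have := norm_le_pi_norm (Θ.mulVec (fun j => (x j : ℝ)) - (fun i => (y i : ℝ))) i
  rwa [Real.norm_eq_abs, Pi.sub_apply, abs_sub_comm] at this

theorem abs_formCoord_inr_le {n m : ℕ} (Θ : Matrix (Fin n) (Fin m) ℝ) (x : Fin m → ℤ)
    (y : Fin n → ℤ) (j : Fin m) : |formCoord Θ x y (Sum.inr j)| ≤ ‖fun j => (x j : ℝ)‖ :=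
  norm_le_pi_norm (fun j => (x j : ℝ)) j

theorem formCoord_ne_zero {n m : ℕ} (Θ : Matrix (Fin n) (Fin m) ℝ) (x : Fin m → ℤ)
    (y : Fin n → ℤ) (h : (x, y) ≠ 0) : formCoord Θ x y ≠ 0 := by
  intro h0
  have hx : x = 0 := by
    ext j
    simpa [formCoord] using congrFun h0 (Sum.inr j)
  apply h
  subst hx
  ext i
  · simp
  · have := congrFun h0 (Sum.inl i)
    have h2 : Θ.mulVec (fun _ => (0 : ℝ)) = 0 := Matrix.mulVec_zero Θ
    simpa [formCoord, h2] using this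

/-! ### Solutions of the transposed system from one or two points -/

/-- Weights of the box `|x'| ≤ s X`, `|Θᵀ x' - y'| ≤ s / A`. -/
noncomputable def boxWeight (n m : ℕ) (s X A : ℝ) : Fin n ⊕ Fin m → ℝ :=
  Sum.elim (fun _ => s * X) (fun _ => s / A)

theorem prod_boxWeight (n m : ℕ) (s X A : ℝ) :
    ∏ i, boxWeight n m s X A i = s ^ (m + n) * (X ^ n / A ^ m) := by
  simp only [boxWeight, Fintype.prod_sum_type, Sum.elim_inl, Sum.elim_inr, Finset.prod_const,
    Finset.card_univ, Fintype.card_fin]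
  rw [mul_pow, div_pow, pow_add]
  ring

theorem boxWeight_pos {n m : ℕ} {s X A : ℝ} (hs : 0 < s) (hX : 0 < X) (hA : 0 < A)
    (i : Fin n ⊕ Fin m) : 0 < boxWeight n m s X A i := by
  rcases i with i | i
  · exact mul_pos hs hX
  · exact div_pos hs hA

theorem exists_solution_of_forms {n m : ℕ} (Θ : Matrix (Fin n) (Fin m) ℝ) {s X A K : ℝ}
    (hs : 0 < s) (hX : 0 < X) (hA : 0 < A) (hK : 0 ≤ K)
    (h : ∃ w : Fin n ⊕ Fin m → ℤ, w ≠ 0 ∧ ∀ i,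
      |(transposeForms Θ).mulVec (fun j => (w j : ℝ)) i| ≤ K * boxWeight n m s X A i) :
    ∃ (x' : Fin n → ℤ) (y' : Fin m → ℤ), (x', y') ≠ 0 ∧
      ‖fun i => (x' i : ℝ)‖ ≤ K * s * X ∧
      ‖Θ.transpose.mulVec (fun i => (x' i : ℝ)) - (fun j => (y' j : ℝ))‖ ≤ K * s / A := by
  obtain ⟨w, hw0, hw⟩ := h
  rw [transposeForms_mulVec] at hw
  refine ⟨w ∘ Sum.inl, w ∘ Sum.inr, ?_, ?_, ?_⟩
  · intro h0
    rw [Prod.mk_eq_zero] at h0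
    apply hw0
    ext (i | i)
    · exact congrFun h0.1 i
    · exact congrFun h0.2 i
  · refine (pi_norm_le_iff_of_nonneg (by positivity)).2 fun i => ?_
    have := hw (Sum.inl i)
    simpa [boxWeight, mul_assoc] using this
  · refine (pi_norm_le_iff_of_nonneg (by positivity)).2 fun i => ?_
    have := hw (Sum.inr i)
    rw [mul_div_assoc]
    exact this

/-- The Dirichlet case ρ = 1; the dilation by 2 supplies the strict inequality in Minkowski's
theorem. -/
theorem exists_transpose_solution {n m : ℕ} (hd : 1 ≤ m + n) (Θ : Matrix (Fin n) (Fin m) ℝ)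
    {X A : ℝ} (hX : 0 < X) (hA : 0 < A) (hXA : A ^ m = X ^ n) :
    ∃ (x' : Fin n → ℤ) (y' : Fin m → ℤ), (x', y') ≠ 0 ∧
      ‖fun i => (x' i : ℝ)‖ ≤ 2 * X ∧
      ‖Θ.transpose.mulVec (fun i => (x' i : ℝ)) - (fun j => (y' j : ℝ))‖ ≤ 2 / A := by
  have hdet := abs_det_transposeForms Θ
  have := exists_solution_of_forms Θ two_pos hX hA zero_le_one (by
    simpa only [one_mul] using exists_int_abs_mulVec_le (transposeForms Θ)
      (boxWeight n m 2 X A) (boxWeight_pos two_pos hX hA)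
      (by rw [← abs_pos, hdet]; exact one_pos)
      (by
        rw [hdet, prod_boxWeight, hXA, div_self (by positivity), mul_one]
        exact one_lt_pow₀ one_lt_two (by omega)))
  simpa only [one_mul] using this

theorem exists_transpose_solution_of_point {n m : ℕ} (hd : 3 ≤ m + n)
    (Θ : Matrix (Fin n) (Fin m) ℝ) {X A C : ℝ} (hX : 0 < X) (hA : 0 < A) (hC : 1 ≤ C)
    (x : Fin m → ℤ) (y : Fin n → ℤ) (hxy : (x, y) ≠ 0)
    (hx : ‖fun j => (x j : ℝ)‖ ≤ C * (A * (X ^ n / A ^ m)))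
    (hL : ‖Θ.mulVec (fun j => (x j : ℝ)) - (fun i => (y i : ℝ))‖ ≤ C * (X ^ n / A ^ m / X)) :
    ∃ (x' : Fin n → ℤ) (y' : Fin m → ℤ), (x', y') ≠ 0 ∧
      ‖fun i => (x' i : ℝ)‖ ≤ (m + n : ℕ) * (8 * C + 1) * X ∧
      ‖Θ.transpose.mulVec (fun i => (x' i : ℝ)) - (fun j => (y' j : ℝ))‖
        ≤ (m + n : ℕ) * (8 * C + 1) / A := by
  set s : ℝ := 8 * C + 1 with hs
  have hs1 : 1 ≤ s := by linarith
  have hs0 : 0 < s := by linarith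
  set ρ := X ^ n / A ^ m with hρ
  have hρ0 : 0 < ρ := by positivity
  -- Dilating by `s` multiplies the product of the weights by `s ^ (m + n)` but the single remaining
  -- weight only by `s`, so a large `s` absorbs `C`.
  have hspow : 2 * (s * C) < s ^ (m + n) := by
    have h1 : s ^ 2 ≤ s ^ (m + n) := pow_le_pow_right₀ hs1 (by omega)
    nlinarith
  refine exists_solution_of_forms Θ hs0 hX hA (Nat.cast_nonneg _) ?_
  have := exists_int_of_one_integral (transposeForms Θ) (abs_det_transposeForms Θ)
    (formCoord Θ x y) (formCoord_ne_zero Θ x y hxy) (formCoord_integral Θ x y)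
    (boxWeight n m s X A) (boxWeight_pos hs0 hX hA) (by
      intro p
      rw [prod_boxWeight, ← hρ]
      have h2 : boxWeight n m s X A p * |formCoord Θ x y p| ≤ s * C * ρ := by
        rcases p with p | p
        · refine (mul_le_mul_of_nonneg_left ((abs_formCoord_inl_le Θ x y p).trans hL)
            (boxWeight_pos hs0 hX hA _).le).trans_eq ?_
          simp only [boxWeight, Sum.elim_inl]
          field_simp
        · refine (mul_le_mul_of_nonneg_left ((abs_formCoord_inr_le Θ x y p).trans hx)
            (boxWeight_pos hs0 hX hA _).le).trans_eq ?_
          simp only [boxWeight, Sum.elim_inr]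
          field_simp
      refine h2.trans_lt ?_
      nlinarith)
  simpa [add_comm] using this

theorem abs_minor_le {a b c d P Q : ℝ} (h1 : |a| * |d| ≤ P) (h2 : |b| * |c| ≤ Q) :
    |a * d - b * c| ≤ P + Q := by
  refine (abs_sub _ _).trans ?_
  rw [abs_mul, abs_mul]
  exact add_le_add h1 h2

theorem exists_transpose_solution_of_pair {n m : ℕ} (hd : 3 ≤ m + n)
    (Θ : Matrix (Fin n) (Fin m) ℝ) {X A C X₁ X₂ L₁ L₂ : ℝ} (hX : 0 < X) (hA : 0 < A) (hC : 1 ≤ C)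
    (x₁ x₂ : Fin m → ℤ) (y₁ y₂ : Fin n → ℤ)
    (hx₁ : ‖fun j => (x₁ j : ℝ)‖ ≤ X₁) (hx₂ : ‖fun j => (x₂ j : ℝ)‖ = X₂) (hX₁₂ : X₁ < X₂)
    (hL₁ : ‖Θ.mulVec (fun j => (x₁ j : ℝ)) - (fun i => (y₁ i : ℝ))‖ = L₁)
    (hL₂ : ‖Θ.mulVec (fun j => (x₂ j : ℝ)) - (fun i => (y₂ i : ℝ))‖ = L₂) (hL₁₂ : L₂ < L₁)
    (hXX : X₁ * X₂ ≤ C * (A ^ 2 * (X ^ n / A ^ m)))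
    (hXL : X₂ * L₁ ≤ C * (A * (X ^ n / A ^ m) / X))
    (hLL : L₁ * L₂ ≤ C * (X ^ n / A ^ m / X ^ 2)) :
    ∃ (x' : Fin n → ℤ) (y' : Fin m → ℤ), (x', y') ≠ 0 ∧
      ‖fun i => (x' i : ℝ)‖ ≤ (m + n : ℕ) * (8 * C + 1) * X ∧
      ‖Θ.transpose.mulVec (fun i => (x' i : ℝ)) - (fun j => (y' j : ℝ))‖
        ≤ (m + n : ℕ) * (8 * C + 1) / A := by
  have hX₁0 : 0 ≤ X₁ := (norm_nonneg _).trans hx₁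
  have hL₂0 : 0 ≤ L₂ := hL₂ ▸ norm_nonneg _
  set ζ := formCoord Θ x₁ y₁ with hζ
  set ξ := formCoord Θ x₂ y₂ with hξ
  have hζl : ∀ i, |ζ (Sum.inl i)| ≤ L₁ := fun i => hL₁ ▸ abs_formCoord_inl_le Θ x₁ y₁ i
  have hξl : ∀ i, |ξ (Sum.inl i)| ≤ L₂ := fun i => hL₂ ▸ abs_formCoord_inl_le Θ x₂ y₂ i
  have hζr : ∀ i, |ζ (Sum.inr i)| ≤ X₁ := fun i => (abs_formCoord_inr_le Θ x₁ y₁ i).trans hx₁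
  have hξr : ∀ i, |ξ (Sum.inr i)| ≤ X₂ := fun i => hx₂ ▸ abs_formCoord_inr_le Θ x₂ y₂ i
  -- If ξ = rζ, then X₁ < X₂ forces |r| > 1, while L₂ < L₁ forces |r| < 1. This needs the exact norm
  -- of `x₂` and the exact error of the first point.
  have hindep : ∃ p q, ζ p * ξ q - ζ q * ξ p ≠ 0 := by
    by_contra! hcon
    have hζ0 : ζ ≠ 0 := by
      intro h0
      have : L₁ ≤ 0 := by
        rw [← hL₁]
        refine (pi_norm_le_iff_of_nonneg le_rfl).2 fun i => ?_
        have h1 := congrFun h0 (Sum.inl i)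
        rw [Real.norm_eq_abs, Pi.sub_apply, abs_sub_comm]
        exact (abs_eq_zero.2 h1).le
      linarith
    obtain ⟨p, hp⟩ := Function.ne_iff.1 hζ0
    have hp : ζ p ≠ 0 := hp
    set r := ξ p / ζ p with hr
    have hmul : ∀ q, ξ q = r * ζ q := by
      intro q
      have := hcon p q
      rw [hr, div_mul_eq_mul_div, eq_div_iff hp]
      linarith
    have h1 : X₂ ≤ |r| * X₁ := by
      rw [← hx₂]
      refine (pi_norm_le_iff_of_nonneg (by positivity)).2 fun j => ?_
      have h2 : (x₂ j : ℝ) = r * ζ (Sum.inr j) := hmul (Sum.inr j)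
      rw [Real.norm_eq_abs, h2, abs_mul]
      exact mul_le_mul_of_nonneg_left (hζr j) (abs_nonneg _)
    have h2 : |r| * L₁ ≤ L₂ := by
      rcases eq_or_ne r 0 with h0 | h0
      · rw [h0]; simpa using hL₂0
      rw [← le_div_iff₀' (abs_pos.2 h0), ← hL₁]
      refine (pi_norm_le_iff_of_nonneg (by positivity)).2 fun i => ?_
      rw [le_div_iff₀' (abs_pos.2 h0), Real.norm_eq_abs, Pi.sub_apply, abs_sub_comm, ← abs_mul]
      have h3 : |r * ζ (Sum.inl i)| ≤ L₂ := (hmul (Sum.inl i)) ▸ hξl i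
      exact h3
    have h3 : 1 < |r| := by
      by_contra! h4
      nlinarith
    nlinarith
  set s : ℝ := 8 * C + 1 with hs
  have hs1 : 1 ≤ s := by linarith
  have hs0 : 0 < s := by linarith
  set ρ := X ^ n / A ^ m with hρ
  have hρ0 : 0 < ρ := by positivity
  -- Weighted minors are at most 2s²Cρ and must stay below s^(m+n)ρ/4. As m + n ≥ 3, any s > 8C
  -- suffices.
  have hspow : 8 * (s ^ 2 * C) < s ^ (m + n) := by
    have h1 : s ^ 3 ≤ s ^ (m + n) := pow_le_pow_right₀ hs1 hd
    have h2 : 0 < s ^ 2 := by positivity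
    have h3 : s ^ 3 = s ^ 2 * (8 * C + 1) := by rw [← hs]; ring
    nlinarith
  have hX₂0 : 0 ≤ X₂ := hX₁0.trans hX₁₂.le
  have hL₁0 : 0 ≤ L₁ := hL₂0.trans hL₁₂.le
  have hXL' : X₁ * L₂ ≤ X₂ * L₁ := mul_le_mul hX₁₂.le hL₁₂.le hL₂0 hX₂0
  refine exists_solution_of_forms Θ hs0 hX hA (Nat.cast_nonneg _) ?_
  have := exists_int_of_two_integral (transposeForms Θ) (abs_det_transposeForms Θ) ζ ξ hindep
    (formCoord_integral Θ x₁ y₁) (formCoord_integral Θ x₂ y₂)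
    (boxWeight n m s X A) (boxWeight_pos hs0 hX hA) (by
      intro p q
      rw [prod_boxWeight, ← hρ]
      have h2 : boxWeight n m s X A p * boxWeight n m s X A q * |ζ p * ξ q - ζ q * ξ p|
          ≤ 2 * (s ^ 2 * C * ρ) := by
        have hpos := (mul_pos (boxWeight_pos (n := n) (m := m) hs0 hX hA p)
          (boxWeight_pos hs0 hX hA q)).le
        rcases p with p | p <;> rcases q with q | q
        · have h3 : |ζ (Sum.inl p) * ξ (Sum.inl q) - ζ (Sum.inl q) * ξ (Sum.inl p)|
              ≤ 2 * (C * (ρ / X ^ 2)) := by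
            have h4 : ∀ i j, |ζ (Sum.inl i)| * |ξ (Sum.inl j)| ≤ C * (ρ / X ^ 2) := fun i j =>
              (mul_le_mul (hζl i) (hξl j) (abs_nonneg _) hL₁0).trans hLL
            rw [two_mul]
            exact abs_minor_le (h4 _ _) (h4 _ _)
          refine (mul_le_mul_of_nonneg_left h3 hpos).trans_eq ?_
          simp only [boxWeight, Sum.elim_inl]
          field_simp
        · have h3 : |ζ (Sum.inl p) * ξ (Sum.inr q) - ζ (Sum.inr q) * ξ (Sum.inl p)|
              ≤ 2 * (C * (A * ρ / X)) := by
            rw [two_mul]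
            refine abs_minor_le ?_ ?_
            · refine (mul_le_mul (hζl _) (hξr _) (abs_nonneg _) hL₁0).trans ?_
              rwa [mul_comm]
            · exact (mul_le_mul (hζr _) (hξl _) (abs_nonneg _) hX₁0).trans (hXL'.trans hXL)
          refine (mul_le_mul_of_nonneg_left h3 hpos).trans_eq ?_
          simp only [boxWeight, Sum.elim_inl, Sum.elim_inr]
          field_simp
        · have h3 : |ζ (Sum.inr p) * ξ (Sum.inl q) - ζ (Sum.inl q) * ξ (Sum.inr p)|
              ≤ 2 * (C * (A * ρ / X)) := by
            rw [two_mul]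
            refine abs_minor_le ?_ ?_
            · exact (mul_le_mul (hζr _) (hξl _) (abs_nonneg _) hX₁0).trans (hXL'.trans hXL)
            · refine (mul_le_mul (hζl _) (hξr _) (abs_nonneg _) hL₁0).trans ?_
              rwa [mul_comm]
          refine (mul_le_mul_of_nonneg_left h3 hpos).trans_eq ?_
          simp only [boxWeight, Sum.elim_inl, Sum.elim_inr]
          field_simp
        · have h3 : |ζ (Sum.inr p) * ξ (Sum.inr q) - ζ (Sum.inr q) * ξ (Sum.inr p)|
              ≤ 2 * (C * (A ^ 2 * ρ)) := by
            have h4 : ∀ i j, |ζ (Sum.inr i)| * |ξ (Sum.inr j)| ≤ C * (A ^ 2 * ρ) := fun i j =>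
              (mul_le_mul (hζr i) (hξr j) (abs_nonneg _) hX₁0).trans hXX
            rw [two_mul]
            exact abs_minor_le (h4 _ _) (h4 _ _)
          refine (mul_le_mul_of_nonneg_left h3 hpos).trans_eq ?_
          simp only [boxWeight, Sum.elim_inr]
          field_simp
      refine h2.trans_lt ?_
      nlinarith)
  simpa [add_comm] using this

/-! ### Best approximations and records of nonincreasing sequences -/

/-- Best approximations to `Θ`: for every `N` there is a nonzero point `(x, y)` with `|x| ≤ N`
that minimizes `|Θ x - y|`. -/
theorem exists_best_approximation {n m : ℕ} (hn : 1 ≤ n) (Θ : Matrix (Fin n) (Fin m) ℝ) (N : ℕ) :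
    ∃ z : (Fin m → ℤ) × (Fin n → ℤ), z ≠ 0 ∧ ‖fun j => (z.1 j : ℝ)‖ ≤ N ∧
      ∀ z' : (Fin m → ℤ) × (Fin n → ℤ), z' ≠ 0 → ‖fun j => (z'.1 j : ℝ)‖ ≤ N →
        ‖Θ.mulVec (fun j => (z.1 j : ℝ)) - (fun i => (z.2 i : ℝ))‖
          ≤ ‖Θ.mulVec (fun j => (z'.1 j : ℝ)) - (fun i => (z'.2 i : ℝ))‖ := by
  let L : (Fin m → ℤ) × (Fin n → ℤ) → ℝ := fun z =>
    ‖Θ.mulVec (fun j => (z.1 j : ℝ)) - (fun i => (z.2 i : ℝ))‖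
  -- A competitor with `x = 0`, admissible even for `N = 0`. Only finitely many points of the strip
  -- do at least as well.
  let z₀ : (Fin m → ℤ) × (Fin n → ℤ) := (0, fun _ => 1)
  have hz₀ : z₀ ≠ 0 := fun h => by
    have := congrFun (congrArg Prod.snd h) ⟨0, hn⟩
    simp [z₀] at this
  let S : Set ((Fin m → ℤ) × (Fin n → ℤ)) := {z | z ≠ 0 ∧ ‖fun j => (z.1 j : ℝ)‖ ≤ N ∧ L z ≤ L z₀}
  obtain ⟨R, hR⟩ : ∃ R : ℝ, ∀ z ∈ S, ‖fun i => (z.2 i : ℝ)‖ ≤ R := by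
    let F : (Fin m → ℝ) →L[ℝ] (Fin n → ℝ) := Θ.mulVecLin.toContinuousLinearMap
    refine ⟨L z₀ + ‖F‖ * N, fun z hz => ?_⟩
    have h1 : ‖Θ.mulVec (fun j => (z.1 j : ℝ))‖ ≤ ‖F‖ * N :=
      (F.le_opNorm _).trans (mul_le_mul_of_nonneg_left hz.2.1 (norm_nonneg _))
    have h2 := norm_sub_norm_le (fun i => (z.2 i : ℝ)) (Θ.mulVec (fun j => (z.1 j : ℝ)))
    rw [norm_sub_rev] at h2
    have h3 : L z ≤ L z₀ := hz.2.2
    simp only [L] at h3 ⊢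
    linarith
  have hfin : S.Finite := by
    refine ((Set.finite_Icc (fun _ : Fin m => -(N : ℤ)) fun _ => (N : ℤ)).prod
      (Set.finite_Icc (fun _ : Fin n => -⌊R⌋) fun _ => ⌊R⌋)).subset fun z hz => ?_
    have h1 : ∀ j, |z.1 j| ≤ (N : ℤ) := fun j => by
      have := (norm_le_pi_norm (fun j => (z.1 j : ℝ)) j).trans hz.2.1
      rw [Real.norm_eq_abs] at this
      exact_mod_cast this
    have h2 : ∀ i, |z.2 i| ≤ ⌊R⌋ := fun i => by
      have := (norm_le_pi_norm (fun j => (z.2 j : ℝ)) i).trans (hR z hz)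
      rw [Real.norm_eq_abs] at this
      rw [Int.le_floor]
      exact_mod_cast this
    exact ⟨⟨fun j => (abs_le.1 (h1 j)).1, fun j => (abs_le.1 (h1 j)).2⟩,
      ⟨fun i => (abs_le.1 (h2 i)).1, fun i => (abs_le.1 (h2 i)).2⟩⟩
  have hz₀S : z₀ ∈ S := by
    refine ⟨hz₀, ?_, le_rfl⟩
    have : (fun j : Fin m => ((z₀.1 j : ℤ) : ℝ)) = 0 := by ext; simp [z₀]
    rw [this, norm_zero]
    positivity
  obtain ⟨z, hz, hmin⟩ := Set.exists_min_image S L hfin ⟨z₀, hz₀S⟩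
  refine ⟨z, hz.1, hz.2.1, fun z' h0 h1 => ?_⟩
  rcases le_total (L z') (L z₀) with h | h
  · exact hmin z' ⟨h0, h1, h⟩
  · exact hz.2.2.trans h

/-- The least index at which an antitone sequence attains the value `φ N`. -/
noncomputable def firstIndex (φ : ℕ → ℝ) (N : ℕ) : ℕ :=
  sInf {K | φ K ≤ φ N}

theorem apply_firstIndex_le (φ : ℕ → ℝ) (N : ℕ) : φ (firstIndex φ N) ≤ φ N :=
  Nat.sInf_mem (s := {K | φ K ≤ φ N}) ⟨N, le_refl (φ N)⟩

theorem firstIndex_le (φ : ℕ → ℝ) (N : ℕ) : firstIndex φ N ≤ N :=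
  Nat.sInf_le (s := {K | φ K ≤ φ N}) (le_refl (φ N))

theorem firstIndex_le_of_apply_le {φ : ℕ → ℝ} {K N : ℕ} (h : φ K ≤ φ N) : firstIndex φ N ≤ K :=
  Nat.sInf_le (s := {K | φ K ≤ φ N}) h

theorem apply_firstIndex {φ : ℕ → ℝ} (hφ : Antitone φ) (N : ℕ) : φ (firstIndex φ N) = φ N :=
  (apply_firstIndex_le φ N).antisymm (hφ (firstIndex_le φ N))

theorem firstIndex_mono {φ : ℕ → ℝ} (hφ : Antitone φ) : Monotone (firstIndex φ) := fun _ N' h =>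
  firstIndex_le_of_apply_le ((apply_firstIndex_le φ N').trans (hφ h))

theorem lt_apply_of_lt_firstIndex {φ : ℕ → ℝ} {K N : ℕ} (h : K < firstIndex φ N) : φ N < φ K := by
  by_contra! h'
  exact (firstIndex_le_of_apply_le h').not_gt h

/-- Either one value of the sequence `φ` is small, or two consecutive record values are small on
average, relative to the parameters `A`, `X`, `ρ`. -/
def HasSmallRecords (φ : ℕ → ℝ) (A X ρ C : ℝ) : Prop :=
  (∃ N : ℕ, (N : ℝ) ≤ C * (A * ρ) ∧ φ N ≤ C * (ρ / X)) ∨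
  ∃ M N : ℕ, M < N ∧ φ N < φ M ∧ (∀ K < N, φ M ≤ φ K) ∧ (M : ℝ) * N ≤ C * (A ^ 2 * ρ) ∧
    N * φ M ≤ C * (A * ρ / X) ∧ φ M * φ N ≤ C * (ρ / X ^ 2)

/-- The search runs over indices up to A, where φ is of order at most A^(-γ) = ρ/X. Going as far as
the bound on the product of consecutive record indices allows makes the product of their values
small. The mixed bound uses γ ≤ 1: T^(1-γ) increases with T. -/
theorem hasSmallRecords_of_le_one {φ : ℕ → ℝ} (hφ : Antitone φ) (h0 : ∀ N, 0 ≤ φ N)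
    {C γ A X ρ : ℝ} (hC : 1 ≤ C) (hγ0 : 0 < γ) (hγ1 : γ ≤ 1)
    (hbound : ∀ N : ℕ, φ N ≤ C * ((N : ℝ) + 1) ^ (-γ)) (hA : 1 ≤ A) (hX : 0 < X)
    (hρ0 : 0 < ρ) (hρ1 : ρ ≤ 1) (hAX : A ^ γ * ρ = X) :
    HasSmallRecords φ A X ρ (C ^ 2) := by
  classical
  have hA0 : 0 < A := by linarith
  have hC0 : 0 < C := by linarith
  have hCC : C ≤ C ^ 2 := by nlinarith
  have hAneg : A ^ (-γ) = ρ / X := by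
    rw [Real.rpow_neg hA0.le, ← hAX]
    field_simp
  have hργ : ρ ^ (-γ) * ρ ≤ 1 := by
    rw [← Real.rpow_add_one hρ0.ne']
    exact Real.rpow_le_one hρ0.le hρ1 (by linarith)
  -- `firstIndex φ (N - 1)` is the index of the last record before `N`, so `P` bounds the product of
  -- indices even when `N` is not itself a record.
  let P : ℕ → Prop := fun N => (firstIndex φ (N - 1) : ℝ) * N ≤ A ^ 2 * ρ
  have hP0 : P 0 := by simp only [P]; simp; positivity
  set N := Nat.findGreatest P ⌊A⌋₊ with hN
  have hPN : P N := Nat.findGreatest_spec (Nat.zero_le _) hP0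
  have hNA : (N : ℝ) ≤ A := (Nat.le_floor_iff hA0.le).1 (Nat.findGreatest_le _)
  set T := firstIndex φ N with hT
  have hTN : T ≤ N := firstIndex_le φ N
  have hφT : φ T = φ N := apply_firstIndex hφ N
  -- the pair of consecutive records ending at `T`
  have pair : 0 < T → φ (T - 1) * φ N ≤ C ^ 2 * (ρ / X ^ 2) →
      HasSmallRecords φ A X ρ (C ^ 2) := by
    intro hT0 hLL
    have hM : φ (firstIndex φ (T - 1)) = φ (T - 1) := apply_firstIndex hφ _
    have hTpos : (0 : ℝ) < T := by exact_mod_cast hT0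
    refine Or.inr ⟨firstIndex φ (T - 1), T, ?_, ?_, ?_, ?_, ?_, ?_⟩
    · exact (firstIndex_le φ _).trans_lt (by omega)
    · rw [hM, hφT]
      exact lt_apply_of_lt_firstIndex (by omega)
    · intro K hK
      rw [hM]
      exact hφ (by omega)
    · have h1 : (firstIndex φ (T - 1) : ℝ) ≤ firstIndex φ (N - 1) := by
        exact_mod_cast firstIndex_mono hφ (by omega)
      have h2 : (T : ℝ) ≤ N := by exact_mod_cast hTN
      have h3 : (firstIndex φ (T - 1) : ℝ) * T ≤ firstIndex φ (N - 1) * N :=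
        mul_le_mul h1 h2 hTpos.le (Nat.cast_nonneg _)
      have h4 : A ^ 2 * ρ ≤ C ^ 2 * (A ^ 2 * ρ) :=
        le_mul_of_one_le_left (by positivity) (by nlinarith)
      exact (h3.trans hPN).trans h4
    · rw [hM]
      have h1 : φ (T - 1) ≤ C * (T : ℝ) ^ (-γ) := by
        have := hbound (T - 1)
        rwa [Nat.cast_sub hT0, Nat.cast_one, sub_add_cancel] at this
      have h2 : (T : ℝ) * (T : ℝ) ^ (-γ) ≤ A * A ^ (-γ) := by
        rw [mul_comm, mul_comm A, ← Real.rpow_add_one hTpos.ne', ← Real.rpow_add_one hA0.ne']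
        refine Real.rpow_le_rpow hTpos.le ?_ (by linarith)
        exact le_trans (by exact_mod_cast hTN) hNA
      have h3 : (T : ℝ) * φ (T - 1) ≤ T * (C * (T : ℝ) ^ (-γ)) :=
        mul_le_mul_of_nonneg_left h1 hTpos.le
      rw [hAneg] at h2
      have h4 : (T : ℝ) * φ (T - 1) ≤ C * (A * (ρ / X)) := by nlinarith
      rw [mul_div_assoc]
      exact h4.trans (mul_le_mul_of_nonneg_right hCC (by positivity))
    · rw [hM, hφT]
      exact hLL
  have hstep : 0 < T → φ (T - 1) ≤ C * (T : ℝ) ^ (-γ) := fun hT0 => by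
    have := hbound (T - 1)
    rwa [Nat.cast_sub hT0, Nat.cast_one, sub_add_cancel] at this
  -- Either the search reaches A, so that φ(N) is already of order ρ/X, or `P (N + 1)` fails and
  -- T(N+1) > A²ρ.
  rcases (Nat.findGreatest_le (P := P) ⌊A⌋₊).eq_or_lt with hfl | hlt
  · have hAN : A ≤ N + 1 := by
      rw [hN, hfl]
      exact (Nat.lt_floor_add_one A).le
    have hφN : φ N ≤ C * (ρ / X) := by
      rw [← hAneg]
      refine (hbound N).trans (mul_le_mul_of_nonneg_left ?_ hC0.le)
      exact Real.rpow_le_rpow_of_nonpos hA0 hAN (by linarith)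
    -- A record with T ≤ Aρ suffices alone; otherwise φ(T-1) is at most C(Aρ)^(-γ) ≤ C/X.
    rcases le_or_gt (T : ℝ) (A * ρ) with hTs | hTb
    · refine Or.inl ⟨T, ?_, ?_⟩
      · exact hTs.trans (le_mul_of_one_le_left (by positivity) (by nlinarith))
      · rw [hφT]
        exact hφN.trans (mul_le_mul_of_nonneg_right hCC (by positivity))
    · have hTpos : (0 : ℝ) < T := lt_trans (by positivity) hTb
      have hT0 : 0 < T := by exact_mod_cast hTpos
      refine pair hT0 ?_
      have h1 : φ (T - 1) ≤ C * (1 / X) := by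
        refine (hstep hT0).trans (mul_le_mul_of_nonneg_left ?_ hC0.le)
        refine (Real.rpow_le_rpow_of_nonpos (by positivity) hTb.le (by linarith)).trans ?_
        rw [Real.mul_rpow hA0.le hρ0.le, hAneg, div_mul_eq_mul_div, mul_comm]
        gcongr
      calc φ (T - 1) * φ N ≤ (C * (1 / X)) * (C * (ρ / X)) :=
            mul_le_mul h1 hφN (h0 _) (by positivity)
        _ = C ^ 2 * (ρ / X ^ 2) := by field_simp
  · have hnot : ¬ P (N + 1) := Nat.findGreatest_is_greatest (n := ⌊A⌋₊) (by omega) (by omega)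
    have hlt' : A ^ 2 * ρ < T * (N + 1) := by
      simpa only [P, not_le, Nat.add_sub_cancel, Nat.cast_add, Nat.cast_one] using hnot
    have hTpos : (0 : ℝ) < T := by
      by_contra! h
      have h1 : 0 < A ^ 2 * ρ := by positivity
      have h2 : (0 : ℝ) ≤ N := Nat.cast_nonneg _
      nlinarith
    have hT0 : 0 < T := by exact_mod_cast hTpos
    refine pair hT0 ?_
    have hN1 : (0 : ℝ) < N + 1 := by positivity
    have h1 : ((T : ℝ) * (N + 1)) ^ (-γ) ≤ ρ / X ^ 2 := by
      refine (Real.rpow_le_rpow_of_nonpos (by positivity) hlt'.le (by linarith)).trans ?_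
      rw [Real.mul_rpow (by positivity) hρ0.le, pow_two, Real.mul_rpow hA0.le hA0.le, hAneg]
      have h2 : ρ / X * (ρ / X) * ρ ^ (-γ) = ρ / X ^ 2 * (ρ ^ (-γ) * ρ) := by field_simp
      rw [h2]
      exact mul_le_of_le_one_right (by positivity) hργ
    calc φ (T - 1) * φ N ≤ (C * (T : ℝ) ^ (-γ)) * (C * ((N : ℝ) + 1) ^ (-γ)) :=
          mul_le_mul (hstep hT0) (hbound N) (h0 _) (by positivity)
      _ = C ^ 2 * ((T : ℝ) * (N + 1)) ^ (-γ) := by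
          rw [Real.mul_rpow hTpos.le hN1.le]; ring
      _ ≤ C ^ 2 * (ρ / X ^ 2) := by gcongr

/-- The previous argument with indices and values exchanged: the search starts where φ drops to 1/X
and stops once the product of consecutive record values is small; minimality bounds the product of
indices. The mixed bound uses γ ≥ 1: v^(1-1/γ) increases with v. -/
theorem hasSmallRecords_of_one_le {φ : ℕ → ℝ} (hφ : Antitone φ) (h0 : ∀ N, 0 ≤ φ N)
    {C γ A X ρ : ℝ} (hC : 1 ≤ C) (hγ1 : 1 ≤ γ)
    (hbound : ∀ N : ℕ, φ N ≤ C * ((N : ℝ) + 1) ^ (-γ)) (hA : 0 < A) (hX : 0 < X)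
    (hρ0 : 0 < ρ) (hρ1 : ρ ≤ 1) (hAX : (A * ρ) ^ γ = X) :
    HasSmallRecords φ A X ρ (C ^ 2) := by
  classical
  have hC0 : 0 < C := by linarith
  have hγ0 : 0 < γ := by linarith
  have hCC : C ≤ C ^ 2 := by nlinarith
  set Y := A * ρ with hY
  have hY0 : 0 < Y := by positivity
  have hA2 : A ^ 2 * ρ = Y ^ 2 / ρ := by rw [hY]; field_simp
  have hXY : X⁻¹ ^ (-(1 / γ)) = Y := by
    rw [← hAX, ← Real.rpow_neg hY0.le, ← Real.rpow_mul hY0.le]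
    rw [show -γ * -(1 / γ) = 1 by field_simp, Real.rpow_one]
  have hργ : ρ ^ (-(1 / γ)) ≤ 1 / ρ := by
    rw [one_div ρ, ← Real.rpow_neg_one]
    refine Real.rpow_le_rpow_of_exponent_ge hρ0 hρ1 ?_
    rw [neg_le_neg_iff, div_le_one hγ0]
    exact hγ1
  -- The decay bound solved for the index. Positivity of φ is required since the real power of 0
  -- carries no information here.
  have hstep : ∀ N : ℕ, 0 < N → 0 < φ (N - 1) → (N : ℝ) ≤ C * φ (N - 1) ^ (-(1 / γ)) := by
    intro N hN hpos
    have hN0 : (0 : ℝ) < N := by exact_mod_cast hN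
    have h1 := hbound (N - 1)
    rw [Nat.cast_sub hN, Nat.cast_one, sub_add_cancel] at h1
    have h2 : φ (N - 1) ≤ (N / C : ℝ) ^ (-γ) := by
      refine h1.trans ?_
      rw [Real.div_rpow hN0.le hC0.le, Real.rpow_neg hC0.le, div_inv_eq_mul, mul_comm]
      refine mul_le_mul_of_nonneg_left ?_ (by positivity)
      exact Real.self_le_rpow_of_one_le hC hγ1
    have h3 := Real.rpow_le_rpow_of_nonpos hpos h2 (z := -(1 / γ)) (by
      rw [neg_nonpos]; positivity)
    rw [← Real.rpow_mul (by positivity), show -γ * -(1 / γ) = 1 by field_simp,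
      Real.rpow_one, div_le_iff₀' hC0] at h3
    exact h3
  have htend : ∀ ε : ℝ, 0 < ε → ∃ N, φ N ≤ ε := by
    intro ε hε
    have h1 : Tendsto (fun N : ℕ => C * ((N : ℝ) + 1) ^ (-γ)) atTop (nhds (C * 0)) := by
      refine Tendsto.const_mul C ((tendsto_rpow_neg_atTop hγ0).comp ?_)
      exact tendsto_atTop_add_const_right _ _ tendsto_natCast_atTop_atTop
    rw [mul_zero] at h1
    obtain ⟨N, hN⟩ := (h1.eventually (ge_mem_nhds hε)).exists
    exact ⟨N, (hbound N).trans hN⟩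
  have hex := htend X⁻¹ (by positivity)
  set M₀ := Nat.find hex with hM₀
  have hM₀le : φ M₀ ≤ X⁻¹ := Nat.find_spec hex
  have hM₀C : (M₀ : ℝ) ≤ C * Y := by
    rcases Nat.eq_zero_or_pos M₀ with h | h
    · rw [h, Nat.cast_zero]; positivity
    have h1 : X⁻¹ < φ (M₀ - 1) := not_le.1 (Nat.find_min hex (by omega))
    have h2 : 0 < X⁻¹ := by positivity
    refine (hstep M₀ h (h2.trans h1)).trans (mul_le_mul_of_nonneg_left ?_ hC0.le)
    rw [← hXY]
    exact Real.rpow_le_rpow_of_nonpos h2 h1.le (by rw [neg_nonpos]; positivity)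
  rcases le_or_gt (φ M₀) (ρ / X) with hs | hb
  · refine Or.inl ⟨M₀, hM₀C.trans (mul_le_mul_of_nonneg_right hCC hY0.le), hs.trans ?_⟩
    exact le_mul_of_one_le_left (by positivity) (by nlinarith)
  have hb0 : 0 < φ M₀ := lt_trans (by positivity) hb
  set σ := ρ / X ^ 2 with hσ
  have hσ0 : 0 < σ := by positivity
  let Q : ℕ → Prop := fun N => M₀ < N ∧ φ N < φ (N - 1) ∧ φ (N - 1) * φ N ≤ σ
  have hQ : ∃ N, Q N := by
    -- The first index below this threshold is a jump; φ(M₀)/2 places it after `M₀`, and σ/φ(M₀)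
    -- makes the product small, even if φ reaches 0.
    have hex' := htend (min (σ / φ M₀) (φ M₀ / 2)) (by positivity)
    have h1 := Nat.find_spec hex'
    set K := Nat.find hex' with hK
    have h2 : M₀ < K := by
      by_contra! h
      have h3 := hφ h
      have h4 := h1.trans (min_le_right _ _)
      linarith
    have h3 : φ K < φ (K - 1) := by
      by_contra! h
      exact Nat.find_min hex' (m := K - 1) (by omega) (h.trans h1)
    refine ⟨K, h2, h3, ?_⟩
    have h4 : φ (K - 1) ≤ φ M₀ := hφ (by omega)
    calc φ (K - 1) * φ K ≤ φ M₀ * (σ / φ M₀) :=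
          mul_le_mul h4 (h1.trans (min_le_left _ _)) (h0 _) hb0.le
      _ = σ := by field_simp
  obtain ⟨hMN, hjump, hprod⟩ := Nat.find_spec hQ
  have hmin : ∀ K < Nat.find hQ, ¬ Q K := fun K hK => Nat.find_min hQ hK
  set N := Nat.find hQ with hN
  clear_value N
  set M := firstIndex φ (N - 1) with hM
  have hφM : φ M = φ (N - 1) := apply_firstIndex hφ _
  have hMltN : M < N := (firstIndex_le φ _).trans_lt (by omega)
  have hφM0 : 0 < φ M := by rw [hφM]; exact (h0 N).trans_lt hjump
  have hφMX : φ M ≤ X⁻¹ := by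
    rw [hφM]
    exact (hφ (by omega)).trans hM₀le
  have hM₀M : M₀ ≤ M := Nat.find_min' hex hφMX
  have hNC : (N : ℝ) ≤ C * φ M ^ (-(1 / γ)) := by
    have := hstep N (by omega) (by rwa [← hφM])
    rwa [← hφM] at this
  have hneg : -(1 / γ) ≤ 0 := by rw [neg_nonpos]; positivity
  refine Or.inr ⟨M, N, hMltN, by rwa [hφM], ?_, ?_, ?_, ?_⟩
  · intro K hK
    rw [hφM]
    exact hφ (by omega)
  · rw [hA2]
    -- At `M₀` the failure of the one-point case gives φ(M) > ρ/X. A later `M` is a jump rejected by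
    -- the search, so φ(M-1)φ(M) > σ.
    rcases hM₀M.eq_or_lt with heq | hlt
    · have h1 : φ M ^ (-(1 / γ)) ≤ (ρ * X⁻¹) ^ (-(1 / γ)) := by
        refine Real.rpow_le_rpow_of_nonpos (by positivity) ?_ hneg
        rw [← div_eq_mul_inv, ← heq]
        exact hb.le
      rw [Real.mul_rpow hρ0.le (by positivity), hXY] at h1
      have h2 : φ M ^ (-(1 / γ)) ≤ 1 / ρ * Y :=
        h1.trans (mul_le_mul_of_nonneg_right hργ hY0.le)
      have h3 : (N : ℝ) ≤ C * (1 / ρ * Y) :=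
        hNC.trans (mul_le_mul_of_nonneg_left h2 hC0.le)
      calc (M : ℝ) * N ≤ (C * Y) * (C * (1 / ρ * Y)) :=
            mul_le_mul (by rwa [← heq]) h3 (Nat.cast_nonneg _) (by positivity)
        _ = C ^ 2 * (Y ^ 2 / ρ) := by field_simp
    · have hjM : φ M < φ (M - 1) := by
        rw [hφM]
        exact lt_apply_of_lt_firstIndex (N := N - 1) (by omega)
      have h1 : σ < φ (M - 1) * φ M := by
        by_contra! h
        exact hmin M hMltN ⟨hlt, hjM, h⟩
      have h2 : (M : ℝ) ≤ C * φ (M - 1) ^ (-(1 / γ)) := hstep M (by omega) (hφM0.trans hjM)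
      have h3 : (φ (M - 1) * φ M) ^ (-(1 / γ)) ≤ 1 / ρ * Y ^ 2 := by
        refine (Real.rpow_le_rpow_of_nonpos hσ0 h1.le hneg).trans ?_
        rw [hσ, show ρ / X ^ 2 = ρ * (X⁻¹ * X⁻¹) by field_simp,
          Real.mul_rpow hρ0.le (by positivity), Real.mul_rpow (by positivity) (by positivity),
          hXY, ← pow_two]
        exact mul_le_mul_of_nonneg_right hργ (by positivity)
      rw [Real.mul_rpow (h0 _) (h0 _)] at h3
      calc (M : ℝ) * N ≤ (C * φ (M - 1) ^ (-(1 / γ))) * (C * φ M ^ (-(1 / γ))) :=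
            mul_le_mul h2 hNC (Nat.cast_nonneg _)
              (mul_nonneg hC0.le (Real.rpow_nonneg (h0 _) _))
        _ = C ^ 2 * (φ (M - 1) ^ (-(1 / γ)) * φ M ^ (-(1 / γ))) := by ring
        _ ≤ C ^ 2 * (1 / ρ * Y ^ 2) := by gcongr
        _ = C ^ 2 * (Y ^ 2 / ρ) := by ring
  · have h1 : φ M ^ (-(1 / γ)) * φ M ≤ X⁻¹ ^ (-(1 / γ)) * X⁻¹ := by
      rw [← Real.rpow_add_one hφM0.ne', ← Real.rpow_add_one (by positivity)]
      refine Real.rpow_le_rpow hφM0.le hφMX ?_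
      have : 1 / γ ≤ 1 := by rw [div_le_one hγ0]; exact hγ1
      linarith
    rw [hXY] at h1
    calc (N : ℝ) * φ M ≤ C * φ M ^ (-(1 / γ)) * φ M := mul_le_mul_of_nonneg_right hNC hφM0.le
      _ = C * (φ M ^ (-(1 / γ)) * φ M) := by ring
      _ ≤ C ^ 2 * (Y * X⁻¹) := mul_le_mul hCC h1 (by positivity) (by positivity)
      _ = C ^ 2 * (Y / X) := by rw [div_eq_mul_inv]
  · rw [hφM]
    exact hprod.trans (le_mul_of_one_le_left hσ0.le (by nlinarith))

/-! ### From exponents to best approximations and back -/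

theorem exists_bound_of_eventually {n m : ℕ} (hn : 1 ≤ n) (Θ : Matrix (Fin n) (Fin m) ℝ) {γ : ℝ}
    (hγ : 0 < γ) (h : ∀ᶠ t : ℝ in atTop, ∃ (x : Fin m → ℤ) (y : Fin n → ℤ), (x, y) ≠ 0 ∧
      ‖(fun j => (x j : ℝ))‖ ≤ t ∧
      ‖Θ.mulVec (fun j => (x j : ℝ)) - (fun i => (y i : ℝ))‖ ≤ t ^ (-γ)) :
    ∃ C : ℝ, 1 ≤ C ∧ ∀ N : ℕ, ∃ z : (Fin m → ℤ) × (Fin n → ℤ), z ≠ 0 ∧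
      ‖(fun j => (z.1 j : ℝ))‖ ≤ N ∧
      ‖Θ.mulVec (fun j => (z.1 j : ℝ)) - (fun i => (z.2 i : ℝ))‖ ≤ C * ((N : ℝ) + 1) ^ (-γ) := by
  obtain ⟨T, hT⟩ := eventually_atTop.1 h
  set R := max T 1 with hR
  have hR1 : 1 ≤ R := le_max_right _ _
  refine ⟨(R + 1) ^ γ, Real.one_le_rpow (by linarith) hγ.le, fun N => ?_⟩
  have hN0 : (0 : ℝ) ≤ N := Nat.cast_nonneg _
  rcases le_or_gt R N with hN | hN
  · obtain ⟨x, y, hxy, hx, hL⟩ := hT N ((le_max_left _ _).trans hN)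
    refine ⟨(x, y), hxy, hx, hL.trans ?_⟩
    have hN1 : (0 : ℝ) < N := by linarith
    rw [Real.rpow_neg hN0, Real.rpow_neg (by positivity), ← div_eq_mul_inv,
      ← Real.div_rpow (by positivity) (by positivity), ← Real.inv_rpow hN0]
    refine Real.rpow_le_rpow (by positivity) ?_ hγ.le
    rw [inv_eq_one_div, div_le_div_iff₀ hN1 (by positivity)]
    nlinarith
  -- For the small `N` the point with `x = 0` has quality at most 1, which the constant (R+1)^γ
  -- absorbs.
  · refine ⟨(0, fun _ => 1), fun h0 => ?_, ?_, ?_⟩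
    · simpa using congrFun (congrArg Prod.snd h0) ⟨0, hn⟩
    · refine (pi_norm_le_iff_of_nonneg hN0).2 fun j => ?_
      simp
    · have h1 : (fun j : Fin m => (((0 : Fin m → ℤ) j : ℤ) : ℝ)) = 0 := by ext; simp
      rw [h1, Matrix.mulVec_zero, zero_sub, norm_neg]
      have h2 : (1 : ℝ) ≤ (R + 1) ^ γ * ((N : ℝ) + 1) ^ (-γ) := by
        rw [Real.rpow_neg (by positivity), ← div_eq_mul_inv, ← Real.div_rpow (by positivity)
          (by positivity)]
        refine Real.one_le_rpow ?_ hγ.le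
        rw [one_le_div (by positivity)]
        linarith
      refine le_trans ?_ h2
      refine (pi_norm_le_iff_of_nonneg zero_le_one).2 fun i => ?_
      simp

/-- The approximation quality of a best approximation, as a function of the size of `x`. -/
noncomputable def bestQuality {n m : ℕ} (Θ : Matrix (Fin n) (Fin m) ℝ) (N : ℕ) : ℝ :=
  sInf ((fun z : (Fin m → ℤ) × (Fin n → ℤ) =>
      ‖Θ.mulVec (fun j => (z.1 j : ℝ)) - (fun i => (z.2 i : ℝ))‖) ''
    {z | z ≠ 0 ∧ ‖fun j => (z.1 j : ℝ)‖ ≤ N})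

theorem bestQuality_le {n m : ℕ} (Θ : Matrix (Fin n) (Fin m) ℝ) (N : ℕ)
    (z : (Fin m → ℤ) × (Fin n → ℤ)) (hz : z ≠ 0) (hzN : ‖fun j => (z.1 j : ℝ)‖ ≤ N) :
    bestQuality Θ N ≤ ‖Θ.mulVec (fun j => (z.1 j : ℝ)) - (fun i => (z.2 i : ℝ))‖ :=
  csInf_le ⟨0, by rintro _ ⟨z, -, rfl⟩; exact norm_nonneg _⟩ ⟨z, ⟨hz, hzN⟩, rfl⟩

theorem exists_eq_bestQuality {n m : ℕ} (hn : 1 ≤ n) (Θ : Matrix (Fin n) (Fin m) ℝ) (N : ℕ) :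
    ∃ z : (Fin m → ℤ) × (Fin n → ℤ), z ≠ 0 ∧ ‖fun j => (z.1 j : ℝ)‖ ≤ N ∧
      ‖Θ.mulVec (fun j => (z.1 j : ℝ)) - (fun i => (z.2 i : ℝ))‖ = bestQuality Θ N := by
  obtain ⟨z, hz, hzN, hmin⟩ := exists_best_approximation hn Θ N
  refine ⟨z, hz, hzN, le_antisymm ?_ (bestQuality_le Θ N z hz hzN)⟩
  refine le_csInf ⟨_, ⟨z, ⟨hz, hzN⟩, rfl⟩⟩ ?_
  rintro _ ⟨z', hz', rfl⟩
  exact hmin z' hz'.1 hz'.2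

theorem bestQuality_nonneg {n m : ℕ} (Θ : Matrix (Fin n) (Fin m) ℝ) (N : ℕ) :
    0 ≤ bestQuality Θ N :=
  Real.sInf_nonneg (by rintro _ ⟨z, -, rfl⟩; exact norm_nonneg _)

theorem bestQuality_antitone {n m : ℕ} (hn : 1 ≤ n) (Θ : Matrix (Fin n) (Fin m) ℝ) :
    Antitone (bestQuality Θ) := by
  intro N N' h
  obtain ⟨z, hz, hzN, hzq⟩ := exists_eq_bestQuality hn Θ N
  rw [← hzq]
  exact bestQuality_le Θ N' z hz (hzN.trans (by exact_mod_cast h))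

theorem norm_intCast_mem_nat {m : ℕ} (x : Fin m → ℤ) :
    ∃ k : ℕ, ‖fun j => (x j : ℝ)‖ = k := by
  refine ⟨Finset.univ.sup fun j => (x j).natAbs, ?_⟩
  refine le_antisymm ((pi_norm_le_iff_of_nonneg (Nat.cast_nonneg _)).2 fun j => ?_) ?_
  · rw [Real.norm_eq_abs, ← Int.cast_abs, ← Int.natCast_natAbs, Int.cast_natCast, Nat.cast_le]
    exact Finset.le_sup (f := fun j => (x j).natAbs) (Finset.mem_univ j)
  · rcases (Finset.univ : Finset (Fin m)).eq_empty_or_nonempty with h | h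
    · rw [h]; simp
    · obtain ⟨j, -, hj⟩ := Finset.exists_mem_eq_sup _ h fun j => (x j).natAbs
      rw [hj]
      refine le_trans (le_of_eq ?_) (norm_le_pi_norm (fun j => (x j : ℝ)) j)
      rw [Real.norm_eq_abs, ← Int.cast_abs, ← Int.natCast_natAbs, Int.cast_natCast]

theorem exists_transpose_solution_of_hasSmallRecords {n m : ℕ} (hn : 1 ≤ n) (hd : 3 ≤ m + n)
    (Θ : Matrix (Fin n) (Fin m) ℝ) {X A C : ℝ} (hX : 0 < X) (hA : 0 < A) (hC : 1 ≤ C)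
    (h : HasSmallRecords (bestQuality Θ) A X (X ^ n / A ^ m) C) :
    ∃ (x' : Fin n → ℤ) (y' : Fin m → ℤ), (x', y') ≠ 0 ∧
      ‖fun i => (x' i : ℝ)‖ ≤ (m + n : ℕ) * (8 * C + 1) * X ∧
      ‖Θ.transpose.mulVec (fun i => (x' i : ℝ)) - (fun j => (y' j : ℝ))‖
        ≤ (m + n : ℕ) * (8 * C + 1) / A := by
  rcases h with ⟨N, hN, hφ⟩ | ⟨M, N, hMN, hφ, hrec, hXX, hXL, hLL⟩
  · obtain ⟨z, hz, hzN, hzq⟩ := exists_eq_bestQuality hn Θ N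
    exact exists_transpose_solution_of_point hd Θ hX hA hC z.1 z.2 hz (hzN.trans hN)
      (hzq.trans_le hφ)
  · obtain ⟨z, hz, hzM, hzq⟩ := exists_eq_bestQuality hn Θ M
    obtain ⟨v, hv, hvN, hvq⟩ := exists_eq_bestQuality hn Θ N
    -- A smaller norm k < N would give φ(k) ≤ φ(N) < φ(M), against the record property.
    have hvN' : ‖fun j => (v.1 j : ℝ)‖ = N := by
      obtain ⟨k, hk⟩ := norm_intCast_mem_nat v.1
      rw [hk] at hvN ⊢
      have h1 : k ≤ N := by exact_mod_cast hvN
      rcases h1.eq_or_lt with h2 | h2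
      · rw [h2]
      · have h3 := hrec k h2
        have h4 := bestQuality_le Θ k v hv hk.le
        rw [hvq] at h4
        linarith
    exact exists_transpose_solution_of_pair hd Θ hX hA hC z.1 v.1 z.2 v.2 hzM hvN'
      (by exact_mod_cast hMN) hzq hvq hφ hXX hXL hLL

/-- Multiplicative constants do not affect the exponent: any δ < β leaves a factor t^(β-δ), which
eventually absorbs K. -/
theorem le_uniformExponent_of_solutions {n m : ℕ} (Θ : Matrix (Fin n) (Fin m) ℝ) {K β : ℝ}
    (hK : 0 < K)
    (h : ∀ X : ℝ, 1 ≤ X → ∃ (x : Fin m → ℤ) (y : Fin n → ℤ), (x, y) ≠ 0 ∧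
      ‖fun j => (x j : ℝ)‖ ≤ K * X ∧
      ‖Θ.mulVec (fun j => (x j : ℝ)) - (fun i => (y i : ℝ))‖ ≤ K / X ^ β) :
    (β : EReal) ≤ uniformExponent Θ := by
  by_contra! hlt
  obtain ⟨δ, hδ1, hδ2⟩ := EReal.lt_iff_exists_real_btwn.1 hlt
  have hδβ : δ < β := by exact_mod_cast hδ2
  refine hδ1.not_ge (le_sSup ⟨δ, ?_, rfl⟩)
  have h1 : Tendsto (fun t : ℝ => t ^ (β - δ)) atTop atTop := tendsto_rpow_atTop (by linarith)
  show ∀ᶠ t : ℝ in atTop, _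
  filter_upwards [eventually_ge_atTop K, h1.eventually_ge_atTop (K * K ^ β)] with t ht1 ht2
  have ht0 : 0 < t := hK.trans_le ht1
  obtain ⟨x, y, hxy, hx, hL⟩ := h (t / K) ((one_le_div hK).2 ht1)
  refine ⟨x, y, hxy, hx.trans_eq (by field_simp), hL.trans ?_⟩
  rw [Real.div_rpow ht0.le hK.le, div_div_eq_mul_div, div_le_iff₀ (by positivity),
    ← Real.rpow_add ht0]
  refine ht2.trans_eq ?_
  congr 1
  ring

theorem div_le_uniformExponent {n m : ℕ} (hn : 1 ≤ n) (Θ : Matrix (Fin n) (Fin m) ℝ) :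
    (((m : ℝ) / n : ℝ) : EReal) ≤ uniformExponent Θ := by
  have hn0 : (0 : ℝ) < n := by exact_mod_cast hn
  refine le_uniformExponent_of_solutions Θ two_pos fun X hX => ?_
  have hX0 : 0 < X := by linarith
  have := exists_transpose_solution (n := m) (m := n) (by omega) Θ.transpose hX0
    (A := X ^ ((m : ℝ) / n)) (by positivity) (by
      rw [← Real.rpow_natCast, ← Real.rpow_mul hX0.le, div_mul_cancel₀ _ hn0.ne',
        Real.rpow_natCast])
  simpa only [Matrix.transpose_transpose] using this

theorem eventually_of_lt_uniformExponent {n m : ℕ} (Θ : Matrix (Fin n) (Fin m) ℝ) {γ : ℝ}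
    (h : (γ : EReal) < uniformExponent Θ) :
    ∀ᶠ t : ℝ in atTop, ∃ (x : Fin m → ℤ) (y : Fin n → ℤ), (x, y) ≠ 0 ∧
      ‖(fun j => (x j : ℝ))‖ ≤ t ∧
      ‖Θ.mulVec (fun j => (x j : ℝ)) - (fun i => (y i : ℝ))‖ ≤ t ^ (-γ) := by
  obtain ⟨_, ⟨δ, hδ, rfl⟩, hlt⟩ := lt_sSup_iff.1 h
  have hγδ : γ < δ := EReal.coe_lt_coe_iff.1 hlt
  have hδ : ∀ᶠ t : ℝ in atTop, _ := hδ
  filter_upwards [hδ, eventually_ge_atTop 1] with t ⟨x, y, hxy, hx, hL⟩ ht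
  exact ⟨x, y, hxy, hx, hL.trans (Real.rpow_le_rpow_of_exponent_le ht (by linarith))⟩

/-- A lower bound `β` for the transposed exponent from records that are small along the family
of parameters `(X, X ^ β)`. -/
theorem le_uniformExponent_transpose_of_hasSmallRecords {n m : ℕ} (hn : 1 ≤ n) (hd : 3 ≤ m + n)
    (Θ : Matrix (Fin n) (Fin m) ℝ) {C β : ℝ} (hC : 1 ≤ C)
    (h : ∀ X : ℝ, 1 ≤ X →
      HasSmallRecords (bestQuality Θ) (X ^ β) X (X ^ n / (X ^ β) ^ m) C) :
    (β : EReal) ≤ uniformExponent Θ.transpose := by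
  have hd0 : (0 : ℝ) < (m + n : ℕ) := by exact_mod_cast (by omega : 0 < m + n)
  refine le_uniformExponent_of_solutions Θ.transpose (K := (m + n : ℕ) * (8 * C + 1))
    (mul_pos hd0 (by linarith)) fun X hX => ?_
  have hX0 : 0 < X := by linarith
  exact exists_transpose_solution_of_hasSmallRecords hn hd Θ hX0 (by positivity) hC (h X hX)

theorem pow_div_rpow_pow {X β : ℝ} (hX : 0 < X) (n m : ℕ) :
    X ^ n / (X ^ β) ^ m = X ^ ((n : ℝ) - β * m) := by
  rw [Real.rpow_sub hX, Real.rpow_natCast, Real.rpow_mul hX.le, Real.rpow_natCast]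

theorem bestQuality_bound {n m : ℕ} (hn : 1 ≤ n) (Θ : Matrix (Fin n) (Fin m) ℝ) {γ : ℝ}
    (hγ : 0 < γ) (h : (γ : EReal) < uniformExponent Θ) :
    ∃ C : ℝ, 1 ≤ C ∧ ∀ N : ℕ, bestQuality Θ N ≤ C * ((N : ℝ) + 1) ^ (-γ) := by
  obtain ⟨C, hC, hbound⟩ := exists_bound_of_eventually hn Θ hγ
    (eventually_of_lt_uniformExponent Θ h)
  refine ⟨C, hC, fun N => ?_⟩
  obtain ⟨z, hz, hzN, hzq⟩ := hbound N
  exact (bestQuality_le Θ N z hz hzN).trans hzq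

theorem div_le_uniformExponent_transpose_of_lt_one {n m : ℕ} (hn : 1 ≤ n) (hm : 1 ≤ m)
    (hd : 3 ≤ m + n) (Θ : Matrix (Fin n) (Fin m) ℝ) {γ : ℝ} (hγ0 : 0 < γ) (hγ1 : γ < 1)
    (h : (γ : EReal) < uniformExponent Θ) :
    ((((n : ℝ) - 1) / (m - γ) : ℝ) : EReal) ≤ uniformExponent Θ.transpose := by
  have hn1 : (1 : ℝ) ≤ n := by exact_mod_cast hn
  have hm1 : (1 : ℝ) ≤ m := by exact_mod_cast hm
  have hmγ : 0 < (m : ℝ) - γ := by linarith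
  -- The claimed bound exceeds Dirichlet's n/m exactly when γn > m, which is also what gives ρ ≤ 1
  -- below.
  rcases le_or_gt (γ * n) m with hle | hlt
  · refine le_trans (EReal.coe_le_coe_iff.2 ?_) (div_le_uniformExponent hm Θ.transpose)
    rw [div_le_div_iff₀ hmγ (by linarith)]
    nlinarith
  obtain ⟨C, hC, hbound⟩ := bestQuality_bound hn Θ hγ0 h
  set β := ((n : ℝ) - 1) / (m - γ) with hβ
  have hβ0 : 0 ≤ β := div_nonneg (by linarith) hmγ.le
  have hβm : β * (m - γ) = n - 1 := div_mul_cancel₀ _ hmγ.ne'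
  refine le_uniformExponent_transpose_of_hasSmallRecords hn hd Θ (C := C ^ 2)
    (by nlinarith) fun X hX => ?_
  have hX0 : 0 < X := by linarith
  refine hasSmallRecords_of_le_one (bestQuality_antitone hn Θ) (bestQuality_nonneg Θ) hC hγ0
    hγ1.le hbound (Real.one_le_rpow hX hβ0) hX0 (by positivity) ?_ ?_
  · rw [pow_div_rpow_pow hX0]
    refine Real.rpow_le_one_of_one_le_of_nonpos hX ?_
    have : (n : ℝ) ≤ β * m := by
      rw [hβ, div_mul_eq_mul_div, le_div_iff₀ hmγ]
      nlinarith
    linarith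
  · rw [pow_div_rpow_pow hX0, ← Real.rpow_mul hX0.le, ← Real.rpow_add hX0,
      show β * γ + (n - β * m) = 1 by linarith, Real.rpow_one]

theorem div_le_uniformExponent_transpose_of_one_le {n m : ℕ} (hn : 1 ≤ n) (hm : 2 ≤ m)
    (Θ : Matrix (Fin n) (Fin m) ℝ) {γ : ℝ} (hγ1 : 1 ≤ γ)
    (h : (γ : EReal) < uniformExponent Θ) :
    ((((n : ℝ) - 1 / γ) / (m - 1) : ℝ) : EReal) ≤ uniformExponent Θ.transpose := by
  have hn1 : (1 : ℝ) ≤ n := by exact_mod_cast hn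
  have hm2 : (2 : ℝ) ≤ m := by exact_mod_cast hm
  have hm1 : 0 < (m : ℝ) - 1 := by linarith
  have hγ0 : 0 < γ := by linarith
  have hγi : γ * (1 / γ) = 1 := by field_simp
  have hγi0 : 0 < 1 / γ := by positivity
  have hγi1 : 1 / γ ≤ 1 := by rw [div_le_one hγ0]; exact hγ1
  -- Again γn > m is exactly the condition for the bound to beat n/m.
  rcases le_or_gt (γ * n) m with hle | hlt
  · refine le_trans (EReal.coe_le_coe_iff.2 ?_) (div_le_uniformExponent (by omega) Θ.transpose)
    rw [div_le_div_iff₀ hm1 (by linarith)]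
    have : (γ * n) * (1 / γ) ≤ m * (1 / γ) := mul_le_mul_of_nonneg_right hle hγi0.le
    nlinarith
  obtain ⟨C, hC, hbound⟩ := bestQuality_bound hn Θ hγ0 h
  set β := ((n : ℝ) - 1 / γ) / (m - 1) with hβ
  have hβ0 : 0 ≤ β := div_nonneg (by linarith) hm1.le
  have hβm : β * (m - 1) = n - 1 / γ := div_mul_cancel₀ _ hm1.ne'
  refine le_uniformExponent_transpose_of_hasSmallRecords hn (by omega) Θ (C := C ^ 2)
    (by nlinarith) fun X hX => ?_
  have hX0 : 0 < X := by linarith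
  refine hasSmallRecords_of_one_le (bestQuality_antitone hn Θ) (bestQuality_nonneg Θ) hC hγ1
    hbound (by positivity) hX0 (by positivity) ?_ ?_
  · rw [pow_div_rpow_pow hX0]
    refine Real.rpow_le_one_of_one_le_of_nonpos hX ?_
    have : (n : ℝ) ≤ β * m := by
      rw [hβ, div_mul_eq_mul_div, le_div_iff₀ hm1]
      have : m * (1 / γ) ≤ (γ * n) * (1 / γ) := mul_le_mul_of_nonneg_right hlt.le hγi0.le
      nlinarith
    linarith
  · rw [pow_div_rpow_pow hX0, ← Real.rpow_add hX0, ← Real.rpow_mul hX0.le,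
      show (β + (n - β * m)) * γ = 1 by
        rw [show β + (n - β * m) = 1 / γ by linarith]; linarith, Real.rpow_one]

/-! ### Passage to the limit in γ and infinite values -/

theorem quotTop_coe_le {a b e : ℝ} (hb : 0 < b) (h : a ≤ e * b) :
    quotTop (a : EReal) (b : EReal) ≤ e := by
  have hb' : (b : EReal) ≠ 0 := by exact_mod_cast hb.ne'
  rw [quotTop, if_neg hb', ← EReal.coe_div, EReal.coe_le_coe_iff, div_le_iff₀ hb]
  exact h

theorem le_apply_of_forall_lt {F : ℝ → ℝ} {a w c : ℝ} (hcw : c < w)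
    (hF : ContinuousAt F w) (h : ∀ γ, c < γ → γ < w → a ≤ F γ) : a ≤ F w := by
  refine ge_of_tendsto (hF.tendsto.mono_left (nhdsWithin_le_nhds (s := Set.Iio w))) ?_
  filter_upwards [Ioo_mem_nhdsLT hcw] with γ hγ
  exact h γ hγ.1 hγ.2

theorem uniformExponent_pos {n m : ℕ} (hn : 1 ≤ n) (hm : 1 ≤ m)
    (Θ : Matrix (Fin n) (Fin m) ℝ) : 0 < uniformExponent Θ := by
  refine lt_of_lt_of_le ?_ (div_le_uniformExponent hn Θ)
  have hn0 : (0 : ℝ) < n := by exact_mod_cast hn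
  have hm0 : (0 : ℝ) < m := by exact_mod_cast hm
  exact_mod_cast div_pos hm0 hn0

theorem quotTop_le_uniformExponent_transpose_of_le_one {n m : ℕ} (hn : 1 ≤ n) (hm : 1 ≤ m)
    (hd : 3 ≤ m + n) (Θ : Matrix (Fin n) (Fin m) ℝ) (h : uniformExponent Θ ≤ 1) :
    quotTop ((n : EReal) - 1) ((m : EReal) - uniformExponent Θ)
      ≤ uniformExponent Θ.transpose := by
  have hE0 := uniformExponent_pos hm hn Θ.transpose
  have hω0 := uniformExponent_pos hn hm Θ
  have hmain := fun (γ : ℝ) (h0 : 0 < γ) (h1 : γ < 1) =>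
    div_le_uniformExponent_transpose_of_lt_one hn hm hd Θ h0 h1
  generalize uniformExponent Θ.transpose = E at *
  generalize uniformExponent Θ = ω at *
  induction ω with
  | bot => simp at hω0
  | top => exact absurd h (not_le.2 (EReal.coe_lt_top 1))
  | coe w =>
    induction E with
    | bot => simp at hE0
    | top => exact le_top
    | coe e =>
      have hw0 : 0 < w := by exact_mod_cast hω0
      have hw1 : w ≤ 1 := by exact_mod_cast h
      have hm1 : (1 : ℝ) ≤ m := by exact_mod_cast hm
      have hlim : (n : ℝ) - 1 ≤ e * (m - w) := by
        refine le_apply_of_forall_lt (F := fun γ => e * (m - γ)) hw0 (by fun_prop) fun γ h0 h1 => ?_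
        have h2 := hmain γ h0 (by linarith) (by exact_mod_cast h1)
        rw [EReal.coe_le_coe_iff, div_le_iff₀ (by linarith)] at h2
        exact h2
      -- A zero denominator means m = w = 1; for finite `e` the limit inequality would then force n
      -- ≤ 1. So the convention a/0 = +∞ is met by an infinite transposed exponent.
      have hmw : 0 < (m : ℝ) - w := by
        refine lt_of_le_of_ne (by linarith) fun h0 => ?_
        rw [← h0, mul_zero] at hlim
        have h1 : (m : ℝ) ≤ 1 := by linarith
        have h2 : (n : ℝ) ≤ 1 := by linarith
        have h3 : m ≤ 1 := by exact_mod_cast h1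
        have h4 : n ≤ 1 := by exact_mod_cast h2
        omega
      have := quotTop_coe_le hmw hlim
      push_cast at this
      exact this

theorem quotTop_le_uniformExponent_transpose_of_one_le {n m : ℕ} (hn : 1 ≤ n) (hm : 1 ≤ m)
    (hd : 3 ≤ m + n) (Θ : Matrix (Fin n) (Fin m) ℝ) (h : 1 ≤ uniformExponent Θ) :
    quotTop ((n : EReal) - (uniformExponent Θ)⁻¹) ((m : EReal) - 1)
      ≤ uniformExponent Θ.transpose := by
  have hE0 := uniformExponent_pos hm hn Θ.transpose
  have hmain := fun (γ : ℝ) (h0 : 0 < γ) (h1 : γ < 1) =>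
    div_le_uniformExponent_transpose_of_lt_one hn hm hd Θ h0 h1
  have hmain' := fun (hm2 : 2 ≤ m) (γ : ℝ) (h1 : 1 ≤ γ) =>
    div_le_uniformExponent_transpose_of_one_le hn hm2 Θ h1
  generalize uniformExponent Θ.transpose = E at *
  generalize uniformExponent Θ = ω at *
  induction E with
  | bot => simp at hE0
  | top => exact le_top
  | coe e =>
    have hm1 : (1 : ℝ) ≤ m := by exact_mod_cast hm
    -- The range γ < 1, let tend to 1, rules out m = 1 for finite `e` and also settles the boundary
    -- value ω = 1.
    have hlim : (n : ℝ) - 1 ≤ e * (m - 1) := by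
      refine le_apply_of_forall_lt (F := fun γ => e * (m - γ)) (w := 1) zero_lt_one (by fun_prop)
        fun γ h0 h1 => ?_
      have h2 := hmain γ h0 h1 (lt_of_lt_of_le (by exact_mod_cast h1) h)
      rw [EReal.coe_le_coe_iff, div_le_iff₀ (by linarith)] at h2
      exact h2
    have hm2 : 2 ≤ m := by
      by_contra! h0
      obtain rfl : m = 1 := by omega
      rw [Nat.cast_one, sub_self, mul_zero] at hlim
      have h2 : (n : ℝ) ≤ 1 := by linarith
      have h4 : n ≤ 1 := by exact_mod_cast h2
      omega
    have hm0 : 0 < (m : ℝ) - 1 := by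
      have : (2 : ℝ) ≤ m := by exact_mod_cast hm2
      linarith
    have hlarge : ∀ γ : ℝ, 1 ≤ γ → (γ : EReal) < ω → (n : ℝ) - 1 / γ ≤ e * (m - 1) := by
      intro γ h1 hγ
      have h2 := hmain' hm2 γ h1 hγ
      rwa [EReal.coe_le_coe_iff, div_le_iff₀ hm0] at h2
    induction ω with
    | bot => exact absurd h (not_le.2 (EReal.bot_lt_coe 1))
    | top =>
      have h1 : (n : ℝ) ≤ e * (m - 1) := by
        have h2 : Tendsto (fun γ : ℝ => (n : ℝ) - 1 / γ) atTop (nhds (n - 0)) := by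
          simp only [one_div]
          exact tendsto_inv_atTop_zero.const_sub _
        rw [sub_zero] at h2
        refine le_of_tendsto h2 ?_
        filter_upwards [eventually_ge_atTop 1] with γ hγ
        exact hlarge γ hγ (EReal.coe_lt_top γ)
      have := quotTop_coe_le hm0 h1
      push_cast at this
      rwa [EReal.inv_top, sub_zero]
    | coe w =>
      have hw1 : 1 ≤ w := by exact_mod_cast h
      have h1 : (n : ℝ) - w⁻¹ ≤ e * (m - 1) := by
        rcases hw1.eq_or_lt with rfl | hw
        · simpa using hlim
        · have h2 : (n : ℝ) ≤ e * (m - 1) + 1 / w := by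
            refine le_apply_of_forall_lt (F := fun γ => e * (m - 1) + 1 / γ) hw
              (continuousAt_const.add (continuousAt_const.div continuousAt_id (by simp; linarith)))
              fun γ h0 h1 => ?_
            have := hlarge γ h0.le (by exact_mod_cast h1)
            linarith
          rw [one_div] at h2
          linarith
      have := quotTop_coe_le hm0 h1
      push_cast at this
      rwa [EReal.coe_inv] at this

/-! ### Simultaneous approximation and one linear form -/

/-- In the definition of the uniform exponent the condition `(x, y) ≠ 0` can be replaced by
`x ≠ 0`. -/
theorem eventually_solution_iff {n m : ℕ} (hm : 1 ≤ m) (Θ : Matrix (Fin n) (Fin m) ℝ) (γ : ℝ) :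
    (∀ᶠ t : ℝ in atTop, ∃ (x : Fin m → ℤ) (y : Fin n → ℤ), (x, y) ≠ 0 ∧
      ‖(fun j => (x j : ℝ))‖ ≤ t ∧
      ‖Θ.mulVec (fun j => (x j : ℝ)) - (fun i => (y i : ℝ))‖ ≤ t ^ (-γ)) ↔
    ∀ᶠ t : ℝ in atTop, ∃ (x : Fin m → ℤ) (y : Fin n → ℤ), x ≠ 0 ∧
      ‖(fun j => (x j : ℝ))‖ ≤ t ∧
      ‖Θ.mulVec (fun j => (x j : ℝ)) - (fun i => (y i : ℝ))‖ ≤ t ^ (-γ) := by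
  constructor
  · intro h
    -- For γ ≤ 0 rounding any nonzero `x` down already works; for γ > 0 and t > 1, `x = 0` would
    -- force |y| < 1, hence `y = 0`.
    rcases le_or_gt γ 0 with hγ | hγ
    · filter_upwards [eventually_ge_atTop 1] with t ht
      refine ⟨fun _ => 1, fun i => ⌊Θ.mulVec (fun _ => ((1 : ℤ) : ℝ)) i⌋, fun h0 => ?_, ?_, ?_⟩
      · simpa using congrFun h0 ⟨0, hm⟩
      · refine le_trans ((pi_norm_le_iff_of_nonneg zero_le_one).2 fun i => ?_) ht
        simp
      · refine le_trans ((pi_norm_le_iff_of_nonneg zero_le_one).2 fun i => ?_)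
          (Real.one_le_rpow ht (by linarith))
        rw [Pi.sub_apply, Int.self_sub_floor, Real.norm_eq_abs, Int.abs_fract]
        exact (Int.fract_lt_one _).le
    · filter_upwards [h, eventually_gt_atTop 1] with t ⟨x, y, hxy, hx, hL⟩ ht
      refine ⟨x, y, fun h0 => hxy ?_, hx, hL⟩
      subst h0
      have h1 : (fun j : Fin m => (((0 : Fin m → ℤ) j : ℤ) : ℝ)) = 0 := by ext; simp
      rw [h1, Matrix.mulVec_zero, zero_sub, norm_neg] at hL
      have h2 : t ^ (-γ) < 1 := Real.rpow_lt_one_of_one_lt_of_neg ht (by linarith)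
      rw [Prod.mk_eq_zero]
      refine ⟨rfl, ?_⟩
      ext i
      have h3 := ((norm_le_pi_norm (fun i => (y i : ℝ)) i).trans hL).trans_lt h2
      rw [Real.norm_eq_abs] at h3
      have h4 : |y i| < 1 := by exact_mod_cast h3
      exact Int.abs_lt_one_iff.1 h4
  · intro h
    filter_upwards [h] with t ⟨x, y, hx0, hx, hL⟩
    exact ⟨x, y, fun h0 => hx0 (Prod.mk_eq_zero.1 h0).1, hx, hL⟩

/-- An `n`-tuple as an `n × 1` matrix. -/
def columnMatrix {n : ℕ} (θ : Fin n → ℝ) : Matrix (Fin n) (Fin 1) ℝ :=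
  Matrix.of fun i _ => θ i

theorem uniformExponentTuple_eq {n : ℕ} (θ : Fin n → ℝ) :
    uniformExponentTuple θ = uniformExponent (columnMatrix θ) := by
  unfold uniformExponentTuple uniformExponent
  congr 2
  ext γ
  rw [Set.mem_ofPred_eq, Set.mem_ofPred_eq, eventually_solution_iff le_rfl]
  refine eventually_congr (Eventually.of_forall fun t => ?_)
  have hnorm : ∀ x : Fin 1 → ℤ, ‖fun j => (x j : ℝ)‖ = |(x 0 : ℝ)| := by
    intro x
    rw [Pi.norm_def]
    simp
  have hmul : ∀ (x : Fin 1 → ℤ) (y : Fin n → ℤ),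
      (columnMatrix θ).mulVec (fun j => (x j : ℝ)) - (fun i => (y i : ℝ))
        = fun i => θ i * (x 0 : ℝ) - (y i : ℝ) := by
    intro x y
    ext i
    simp [columnMatrix, Matrix.mulVec, dotProduct]
  constructor
  · rintro ⟨x, y, h0, hx, hL⟩
    refine ⟨fun _ => x, y, fun h => ?_, by rwa [hnorm], by rwa [hmul]⟩
    have h1 : x = 0 := congrFun h 0
    simp [h1] at h0
  · rintro ⟨x, y, h0, hx, hL⟩
    rw [hnorm] at hx
    rw [hmul] at hL
    refine ⟨x 0, y, abs_pos.2 fun h => h0 ?_, hx, hL⟩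
    ext j
    rw [Subsingleton.elim j 0]
    exact_mod_cast h

theorem uniformExponentForm_eq {n : ℕ} (hn : 1 ≤ n) (θ : Fin n → ℝ) :
    uniformExponentForm θ = uniformExponent (columnMatrix θ).transpose := by
  unfold uniformExponentForm uniformExponent
  congr 2
  ext γ
  rw [Set.mem_ofPred_eq, Set.mem_ofPred_eq, eventually_solution_iff hn]
  refine eventually_congr (Eventually.of_forall fun t => ?_)
  have hnorm : ∀ (x : Fin n → ℤ) (y : Fin 1 → ℤ),
      ‖(columnMatrix θ).transpose.mulVec (fun j => (x j : ℝ)) - (fun i => (y i : ℝ))‖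
        = |(∑ i, θ i * (x i : ℝ)) - (y 0 : ℝ)| := by
    intro x y
    rw [Pi.norm_def]
    simp [columnMatrix, Matrix.mulVec, dotProduct]
  have hpos : ∀ x : Fin n → ℤ, 0 < ‖fun i => (x i : ℝ)‖ ↔ x ≠ 0 := by
    intro x
    rw [norm_pos_iff, not_iff_not]
    constructor
    · intro h
      ext i
      simpa using congrFun h i
    · rintro rfl
      ext; simp
  constructor
  · rintro ⟨x, y, h0, hx, hL⟩
    exact ⟨x, fun _ => y, (hpos x).1 h0, hx, by rwa [hnorm]⟩
  · rintro ⟨x, y, h0, hx, hL⟩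
    exact ⟨x, y 0, (hpos x).2 h0, hx, by rwa [hnorm] at hL⟩

theorem int_mul_eq_of_abs_lt {ϑ ε : ℝ} {N : ℕ} {x y x' y' : ℤ} (hx : |(x : ℝ)| ≤ N)
    (hx' : |(x' : ℝ)| ≤ N + 1) (hL : |ϑ * x - y| ≤ ε) (hL' : |ϑ * x' - y'| ≤ ε)
    (hε : (2 * N + 1) * ε < 1) : x * y' = x' * y := by
  have h1 : ((x * y' - x' * y : ℤ) : ℝ) = x' * (ϑ * x - y) - x * (ϑ * x' - y') := by
    push_cast; ring
  have hε0 : 0 ≤ ε := (abs_nonneg _).trans hL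
  have h2 : |((x * y' - x' * y : ℤ) : ℝ)| < 1 := by
    rw [h1]
    refine (abs_sub _ _).trans_lt ?_
    rw [abs_mul, abs_mul]
    have h3 := mul_le_mul hx' hL (abs_nonneg _) (by positivity)
    have h4 := mul_le_mul hx hL' (abs_nonneg _) (by positivity)
    linarith
  have h3 : |x * y' - x' * y| < 1 := by exact_mod_cast h2
  linarith [Int.abs_lt_one_iff.1 h3]

/-- With γ > 1, solutions for `N` and `N + 1` have an integer determinant of absolute value below 1,
so all the fractions y/x eventually coincide, and their common value must be the irrational
coordinate. -/
theorem uniformExponentTuple_le_one {n : ℕ} (θ : Fin n → ℝ) (h : ∃ i, Irrational (θ i)) :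
    uniformExponentTuple θ ≤ 1 := by
  obtain ⟨i, hi⟩ := h
  by_contra! hlt
  obtain ⟨_, ⟨γ, hγ, rfl⟩, hγ1⟩ := lt_sSup_iff.1 hlt
  have hγ1 : 1 < γ := EReal.coe_lt_coe_iff.1 hγ1
  have hγ : ∀ᶠ t : ℝ in atTop, ∃ (x : ℤ) (y : Fin n → ℤ), 0 < |(x : ℝ)| ∧ |(x : ℝ)| ≤ t ∧
      ‖(fun i => θ i * (x : ℝ) - (y i : ℝ))‖ ≤ t ^ (-γ) := hγ
  have hsmall : Tendsto (fun t : ℝ => 3 * t ^ (-(γ - 1))) atTop (nhds (3 * 0)) :=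
    (tendsto_rpow_neg_atTop (by linarith)).const_mul 3
  rw [mul_zero] at hsmall
  obtain ⟨T, hT⟩ := eventually_atTop.1
    (hγ.and ((hsmall.eventually (gt_mem_nhds one_pos)).and (eventually_ge_atTop 1)))
  have hsol : ∀ N : ℕ, T ≤ N → ∃ x y : ℤ, x ≠ 0 ∧ |(x : ℝ)| ≤ N ∧
      |θ i * x - y| ≤ (N : ℝ) ^ (-γ) := by
    intro N hN
    obtain ⟨⟨x, y, h0, hx, hL⟩, -, -⟩ := hT N hN
    refine ⟨x, y i, fun h => by simp [h] at h0, hx, ?_⟩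
    exact (norm_le_pi_norm (fun i => θ i * (x : ℝ) - (y i : ℝ)) i).trans hL
  choose! x y hx0 hx hL using hsol
  obtain ⟨N₀, hN₀⟩ := exists_nat_ge T
  have hT' : ∀ N, N₀ ≤ N → T ≤ (N : ℝ) := fun N hN => hN₀.trans (by exact_mod_cast hN)
  have hcross : ∀ N, N₀ ≤ N → x N * y (N + 1) = x (N + 1) * y N := by
    intro N hN
    obtain ⟨-, h1, h2⟩ := hT N (hT' N hN)
    have hN0 : (0 : ℝ) < N := by linarith
    refine int_mul_eq_of_abs_lt (ϑ := θ i) (ε := (N : ℝ) ^ (-γ)) (hx N (hT' N hN)) ?_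
      (hL N (hT' N hN)) ?_ ?_
    · simpa using hx (N + 1) (hT' _ (by omega))
    · refine (hL (N + 1) (hT' _ (by omega))).trans ?_
      exact Real.rpow_le_rpow_of_nonpos hN0 (by push_cast; linarith) (by linarith)
    · refine lt_of_le_of_lt ?_ h1
      rw [show -(γ - 1) = -γ + 1 by ring, Real.rpow_add_one hN0.ne']
      have : 0 < (N : ℝ) ^ (-γ) := by positivity
      nlinarith
  have hratio : ∀ N, N₀ ≤ N → (y N : ℝ) / x N = y N₀ / x N₀ := by
    intro N hN
    induction N, hN using Nat.le_induction with
    | base => rfl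
    | succ N hN ih =>
      rw [← ih]
      have h1 : (x N : ℝ) ≠ 0 := by exact_mod_cast hx0 N (hT' N hN)
      have h2 : (x (N + 1) : ℝ) ≠ 0 := by exact_mod_cast hx0 (N + 1) (hT' _ (by omega))
      rw [div_eq_div_iff h2 h1]
      have := hcross N hN
      have h3 : (x N : ℝ) * y (N + 1) = x (N + 1) * y N := by exact_mod_cast this
      linarith
  have hdist : ∀ N, N₀ ≤ N → |θ i - y N₀ / x N₀| ≤ (N : ℝ) ^ (-γ) := by
    intro N hN
    rw [← hratio N hN]
    have h1 := hx0 N (hT' N hN)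
    have h2 : (1 : ℝ) ≤ |(x N : ℝ)| := by exact_mod_cast Int.one_le_abs h1
    have h3 : (x N : ℝ) ≠ 0 := by exact_mod_cast h1
    have h4 : θ i * x N - y N = (θ i - y N / x N) * x N := by field_simp
    have h5 := hL N (hT' N hN)
    rw [h4, abs_mul] at h5
    exact (le_mul_of_one_le_right (abs_nonneg _) h2).trans h5
  have hzero : |θ i - y N₀ / x N₀| ≤ 0 := by
    have h1 : Tendsto (fun N : ℕ => (N : ℝ) ^ (-γ)) atTop (nhds 0) :=
      (tendsto_rpow_neg_atTop (by linarith)).comp tendsto_natCast_atTop_atTop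
    refine ge_of_tendsto h1 ?_
    filter_upwards [eventually_ge_atTop N₀] with N hN
    exact hdist N hN
  refine hi ⟨(y N₀ : ℚ) / x N₀, ?_⟩
  have := abs_eq_zero.1 (hzero.antisymm (abs_nonneg _))
  push_cast
  linarith

theorem theoremt :
    (∀ (n m : ℕ), 1 ≤ n → 1 ≤ m → 3 ≤ m + n → ∀ Θ : Matrix (Fin n) (Fin m) ℝ,
      (uniformExponent Θ ≤ 1 →
        quotTop ((n : EReal) - 1) ((m : EReal) - uniformExponent Θ)
          ≤ uniformExponent Θ.transpose) ∧
      (1 ≤ uniformExponent Θ →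
        quotTop ((n : EReal) - (uniformExponent Θ)⁻¹) ((m : EReal) - 1)
          ≤ uniformExponent Θ.transpose)) ∧
    (∀ n : ℕ, 2 ≤ n → ∀ θ : Fin n → ℝ, (∃ i, Irrational (θ i)) →
      quotTop ((n : EReal) - 1) (1 - uniformExponentTuple θ) ≤ uniformExponentForm θ ∧
      quotTop (1 - (uniformExponentForm θ)⁻¹) ((n : EReal) - 1) ≤ uniformExponentTuple θ) := by
  refine ⟨fun n m hn hm hd Θ =>
    ⟨quotTop_le_uniformExponent_transpose_of_le_one hn hm hd Θ,
      quotTop_le_uniformExponent_transpose_of_one_le hn hm hd Θ⟩, fun n hn θ hθ => ⟨?_, ?_⟩⟩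
  · have h1 := uniformExponentTuple_le_one θ hθ
    rw [uniformExponentTuple_eq] at h1 ⊢
    rw [uniformExponentForm_eq (by omega)]
    simpa using quotTop_le_uniformExponent_transpose_of_le_one (by omega) le_rfl (by omega)
      (columnMatrix θ) h1
  · rw [uniformExponentTuple_eq, uniformExponentForm_eq (by omega)]
    have h1 : 1 ≤ uniformExponent (columnMatrix θ).transpose := by
      refine le_trans ?_ (div_le_uniformExponent le_rfl _)
      rw [Nat.cast_one, div_one]
      exact_mod_cast (by omega : 1 ≤ n)
    simpa using quotTop_le_uniformExponent_transpose_of_one_le le_rfl (by omega) (by omega)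
      (columnMatrix θ).transpose h1
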